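/- Let $d\ge 1$ and let $M_d$ be the space of complex $d\times d$ matrices. For a linear map $\Phi:M_d\to M_d$ let $$\|\Phi\|_\diamond=\max_{X\in M_d\otimes M_d,\ \|X\|_1=1}\|(\Phi\otimes \mathbb 1)(X)\|_1$$ denote its diamond norm, where $\mathbb 1$ is the identity map on $M_d$ and $\|X\|_1=\operatorname{tr}\sqrt{X^\dagger X}$ is the trace norm. For a unitary $U\in M_d$ let $\Phi_U(\rho)=U\rho U^\dagger$ be the corresponding unitary channel, and let $$\mathcal P_U(\rho)=\sum_{i=1}^d\langle u_i|\rho|u_i\rangle\,|i\rangle\langle i|,\qquad |u_i\rangle=U|i\rangle,$$ be the von Neumann measurement channel in the orthonormal basis given by the columns of $U$. Let $\mathcal{DU}_d$ be the set of diagonal unitary $d\times d$ matrices. Then for all unitary $U,V\in M_d$ $$\|\mathcal P_U-\mathcal P_V\|_\diamond=\min_{E\in\mathcal{DU}_d}\|\Phi_{UE}-\Phi_V\|_\diamond ,$$ where the minimum is attained. -/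

import Mathlib

open scoped Matrix Kronecker

noncomputable section

/-- The trace norm of a square complex matrix: the sum of its singular values, i.e. of the square
roots of the eigenvalues (with multiplicity) of `Xᴴ * X`. -/
def traceNorm {n : Type*} [Fintype n] [DecidableEq n] (X : Matrix n n ℂ) : ℝ :=
  ∑ i, √((Matrix.isHermitian_conjTranspose_mul_self X).eigenvalues i)

/-- The map `Φ ⊗ 𝟙 : M_m ⊗ M_k → M_n ⊗ M_k` (with `M_n ⊗ M_k` realised as matrices indexed by
`n × k`, as for the Kronecker product): `Φ` is applied to each `m × m` block obtained by fixing the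
two ancilla indices. -/
def ampliation {m n : Type*} (k : Type*) (Φ : Matrix m m ℂ →ₗ[ℂ] Matrix n n ℂ) :
    Matrix (m × k) (m × k) ℂ →ₗ[ℂ] Matrix (n × k) (n × k) ℂ where
  toFun X := Matrix.of fun p q => Φ (Matrix.of fun i j => X (i, p.2) (j, q.2)) p.1 q.1
  map_add' X Y := by
    ext p q
    exact congrFun (congrFun (Φ.map_add (Matrix.of fun i j => X (i, p.2) (j, q.2))
      (Matrix.of fun i j => Y (i, p.2) (j, q.2))) p.1) q.1
  map_smul' c X := by
    ext p q
    exact congrFun (congrFun (Φ.map_smul c (Matrix.of fun i j => X (i, p.2) (j, q.2))) p.1) q.1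

/-- `ampliation k Φ` acts on elementary tensors as `Φ ⊗ 𝟙`. -/
theorem ampliation_kronecker {m n k : Type*} (Φ : Matrix m m ℂ →ₗ[ℂ] Matrix n n ℂ)
    (A : Matrix m m ℂ) (B : Matrix k k ℂ) : ampliation k Φ (A ⊗ₖ B) = Φ A ⊗ₖ B := by
  ext p q
  have h : (Matrix.of fun i j => (A ⊗ₖ B) (i, p.2) (j, q.2)) = B p.2 q.2 • A := by
    ext i j
    simp [mul_comm]
  change Φ (Matrix.of fun i j => (A ⊗ₖ B) (i, p.2) (j, q.2)) p.1 q.1 = Φ A p.1 q.1 * B p.2 q.2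
  rw [h, map_smul, Matrix.smul_apply, smul_eq_mul, mul_comm]

/-- The diamond norm (completely bounded trace norm) of a linear map `Φ : M_m → M_n`: the maximum
of `‖(Φ ⊗ 𝟙) X‖₁` over `‖X‖₁ = 1`, where `𝟙` is the identity map on `M_m`. -/
def diamondNorm {m n : Type*} [Fintype m] [DecidableEq m] [Fintype n] [DecidableEq n]
    (Φ : Matrix m m ℂ →ₗ[ℂ] Matrix n n ℂ) : ℝ :=
  sSup {r : ℝ | ∃ X : Matrix (m × m) (m × m) ℂ,
    traceNorm X = 1 ∧ r = traceNorm (ampliation m Φ X)}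

open scoped Matrix.Norms.L2Operator MatrixOrder in
theorem continuous_traceNorm {n : Type*} [Fintype n] [DecidableEq n] :
    Continuous (traceNorm : Matrix n n ℂ → ℝ) := by
  have h1 : (traceNorm : Matrix n n ℂ → ℝ) =
      fun X => (Matrix.trace (cfc Real.sqrt (Xᴴ * X))).re := by
    funext X
    rw [(Matrix.isHermitian_conjTranspose_mul_self X).cfc_eq, Matrix.IsHermitian.cfc,
      Unitary.conjStarAlgAut_apply, Matrix.trace_mul_cycle]
    simp [traceNorm, Matrix.trace_diagonal]
  rw [h1]
  have h2 : Continuous fun X : Matrix n n ℂ => cfc Real.sqrt (Xᴴ * X) := by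
    have h0 : Continuous fun X : Matrix n n ℂ => Xᴴ * X :=
      continuous_id.matrix_conjTranspose.matrix_mul continuous_id
    exact Continuous.cfc_of_mem_nhdsSet (s := Set.univ) Real.sqrt Filter.univ_mem h0
      (fun X => Matrix.isHermitian_conjTranspose_mul_self X) Real.continuous_sqrt.continuousOn
  exact Complex.continuous_re.comp h2.matrix_trace

theorem sum_normSq_le_traceNorm_sq {n : Type*} [Fintype n] [DecidableEq n] (X : Matrix n n ℂ) :
    ∑ i, ∑ j, ‖X i j‖ ^ 2 ≤ traceNorm X ^ 2 := by
  have h1 : ∑ i, (Matrix.isHermitian_conjTranspose_mul_self X).eigenvalues i =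
      ∑ i, ∑ j, ‖X i j‖ ^ 2 := by
    have h := (Matrix.isHermitian_conjTranspose_mul_self X).trace_eq_sum_eigenvalues
    have h' : (Xᴴ * X).trace = ((∑ i, ∑ j, ‖X i j‖ ^ 2 : ℝ) : ℂ) := by
      rw [Finset.sum_comm]
      push_cast
      simp only [Matrix.trace, Matrix.diag_apply, Matrix.mul_apply, Matrix.conjTranspose_apply]
      exact Finset.sum_congr rfl fun i _ => Finset.sum_congr rfl fun j _ => by
        simpa using Complex.conj_mul' (X j i)
    rw [h'] at h
    rw [Complex.ofReal_sum] at h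
    refine Complex.ofReal_injective ?_
    rw [Complex.ofReal_sum, Complex.ofReal_sum]
    exact h.symm
  rw [← h1, traceNorm]
  calc _ = ∑ i, √((Matrix.isHermitian_conjTranspose_mul_self X).eigenvalues i) ^ 2 :=
        Finset.sum_congr rfl fun i _ =>
          (Real.sq_sqrt (Matrix.eigenvalues_conjTranspose_mul_self_nonneg X i)).symm
    _ ≤ _ := Finset.sum_sq_le_sq_sum_of_nonneg fun i _ => Real.sqrt_nonneg _

/-- The supremum defining the diamond norm is a maximum. -/
theorem diamondNorm_isGreatest {m n : Type*} [Fintype m] [DecidableEq m] [Nonempty m]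
    [Fintype n] [DecidableEq n] (Φ : Matrix m m ℂ →ₗ[ℂ] Matrix n n ℂ) :
    IsGreatest {r : ℝ | ∃ X : Matrix (m × m) (m × m) ℂ,
      traceNorm X = 1 ∧ r = traceNorm (ampliation m Φ X)} (diamondNorm Φ) := by
  have hc : Continuous fun X => traceNorm (ampliation m Φ X) :=
    continuous_traceNorm.comp (LinearMap.continuous_of_finiteDimensional _)
  have hK : IsCompact {X : Matrix (m × m) (m × m) ℂ | traceNorm X = 1} := by
    refine IsCompact.of_isClosed_subset (isCompact_univ_pi fun _ => isCompact_univ_pi fun _ =>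
      isCompact_closedBall (0 : ℂ) 1) (isClosed_eq continuous_traceNorm continuous_const) ?_
    intro X hX i _ j _
    have h1 := sum_normSq_le_traceNorm_sq X
    have hX' : traceNorm X = 1 := hX
    rw [hX'] at h1
    have h2 : ‖X i j‖ ^ 2 ≤ ∑ j, ‖X i j‖ ^ 2 :=
      Finset.single_le_sum (f := fun j => ‖X i j‖ ^ 2) (fun _ _ => by positivity)
        (Finset.mem_univ j)
    have h3 : ∑ j, ‖X i j‖ ^ 2 ≤ ∑ i, ∑ j, ‖X i j‖ ^ 2 :=
      Finset.single_le_sum (f := fun i => ∑ j, ‖X i j‖ ^ 2) (fun _ _ => by positivity)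
        (Finset.mem_univ i)
    rw [mem_closedBall_zero_iff]
    nlinarith [norm_nonneg (X i j)]
  have hne : {X : Matrix (m × m) (m × m) ℂ | traceNorm X = 1}.Nonempty := by
    have h0 : traceNorm (0 : Matrix (m × m) (m × m) ℂ) ≤ 1 := by
      have h : (Matrix.isHermitian_conjTranspose_mul_self
          (0 : Matrix (m × m) (m × m) ℂ)).eigenvalues = 0 := by
        rw [Matrix.IsHermitian.eigenvalues_eq_zero_iff]
        simp
      rw [traceNorm, h]
      simp
    have h1 : 1 ≤ traceNorm (1 : Matrix (m × m) (m × m) ℂ) := by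
      have h := sum_normSq_le_traceNorm_sq (1 : Matrix (m × m) (m × m) ℂ)
      have h' : ∑ i : m × m, ∑ j, ‖(1 : Matrix (m × m) (m × m) ℂ) i j‖ ^ 2 =
          Fintype.card (m × m) := by
        simp [Matrix.one_apply, apply_ite]
      have h3 : (1 : ℝ) ≤ Fintype.card (m × m) := by exact_mod_cast Fintype.card_pos
      have h4 : 0 ≤ traceNorm (1 : Matrix (m × m) (m × m) ℂ) :=
        Finset.sum_nonneg fun i _ => Real.sqrt_nonneg _
      nlinarith
    obtain ⟨X, hX⟩ := mem_range_of_exists_le_of_exists_ge continuous_traceNorm ⟨0, h0⟩ ⟨1, h1⟩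
    exact ⟨X, hX⟩
  obtain ⟨X, hX, hmax⟩ := hK.exists_isMaxOn hne hc.continuousOn
  have hG : IsGreatest {r : ℝ | ∃ X : Matrix (m × m) (m × m) ℂ,
      traceNorm X = 1 ∧ r = traceNorm (ampliation m Φ X)} (traceNorm (ampliation m Φ X)) := by
    refine ⟨⟨X, hX, rfl⟩, ?_⟩
    rintro r ⟨Y, hY, rfl⟩
    exact hmax hY
  rw [diamondNorm, hG.csSup_eq]
  exact hG

/-- The unitary channel `Φ_U : ρ ↦ U ρ U†`. -/
def unitaryChannel {n : Type*} [Fintype n] (U : Matrix n n ℂ) :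
    Matrix n n ℂ →ₗ[ℂ] Matrix n n ℂ where
  toFun ρ := U * ρ * Uᴴ
  map_add' ρ σ := by rw [Matrix.mul_add, Matrix.add_mul]
  map_smul' c ρ := by simp

/-- The measurement channel `P_U : ρ ↦ ∑ i, ⟨u_i|ρ|u_i⟩ |i⟩⟨i|` of the von Neumann measurement in
the basis formed by the columns `|u_i⟩ = U|i⟩` of `U`. -/
def measurementChannel {n : Type*} [Fintype n] [DecidableEq n] (U : Matrix n n ℂ) :
    Matrix n n ℂ →ₗ[ℂ] Matrix n n ℂ where
  toFun ρ := ∑ i, (star (U.col i) ⬝ᵥ (ρ *ᵥ U.col i)) • Matrix.single i i (1 : ℂ)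
  map_add' ρ σ := by
    simp only [Matrix.add_mulVec, dotProduct_add, add_smul, Finset.sum_add_distrib]
  map_smul' c ρ := by
    simp only [Matrix.smul_mulVec, dotProduct_smul, smul_assoc, Finset.smul_sum, RingHom.id_apply]

/-- The set `DU_d` of diagonal unitary `d × d` matrices. -/
def diagonalUnitary (d : ℕ) : Set (Matrix (Fin d) (Fin d) ℂ) :=
  {E | E ∈ Matrix.unitaryGroup (Fin d) ℂ ∧ E.IsDiag}

end

/-! Both inequalities rest on `P_U` being conjugation by `Uᴴ` followed by dephasing in the standard
basis.

Measurement side at most unitary side: `P_U` does not see column phases, so `U` may be replaced by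
`U * E`. Dephasing contracts the trace norm, and inverting both unitaries does not raise the diamond
distance (`diamondNorm_measurementChannel_sub_le`).

Attainment is a saddle point argument for `R = Vᴴ * U`. Let `t` be the minimum of `∑ i, ‖(σ * R) i
i‖` over density matrices `σ`. If `t > 0`, Hahn-Banach separation gives a diagonal contraction `z`
such that the quadratic form of `R * diagonal z` has real part at least `t`
(`exists_diagonal_of_le_sum_norm`). Keeping only the phases `e` of `z` preserves this bound and
makes `K = R * diagonal e` unitary (`exists_phases_posSemidef`). For `t < 1` the unitary channels
are then at distance at most `2 * √(1 - t ^ 2)` (`diamondNorm_unitaryChannel_sub_le`). Conversely,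
complementary slackness puts a minimizer `σ` on the eigenspace of `K + Kᴴ` for `2 * t`. Averaging
`σ` over a reflection of that space gives `τ` commuting with `K` (`exists_density_of_saddle`). The
pure input whose reduced state is `V * τ * Vᴴ` makes the measurements differ by at least `2 * √(1 -
t ^ 2)` (`sum_sqrt_density_le`). If `t = 0`, `σ` already yields the maximal value 2; if `t ≥ 1`, the
phases make `U * diagonal e = V`. -/

open scoped Matrix Kronecker

/-! ### Trace norm: duality with contractions, rank-one bounds, block structure. -/

section TraceNorm

open Matrix
open scoped Matrix.Norms.L2Operator

variable {m n : Type*} [Fintype m] [Fintype n]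

/-- The Euclidean norm of a complex vector. -/
noncomputable def euclNorm (x : n → ℂ) : ℝ := ‖WithLp.toLp 2 x‖

theorem euclNorm_nonneg (x : n → ℂ) : 0 ≤ euclNorm x := norm_nonneg _

theorem euclNorm_sq (x : n → ℂ) : euclNorm x ^ 2 = ∑ i, ‖x i‖ ^ 2 :=
  EuclideanSpace.norm_sq_eq _

theorem star_dotProduct_self (x : n → ℂ) : star x ⬝ᵥ x = ((euclNorm x ^ 2 : ℝ) : ℂ) := by
  rw [euclNorm_sq, dotProduct, Complex.ofReal_sum]
  exact Finset.sum_congr rfl fun i _ => by simpa using Complex.conj_mul' (x i)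

theorem euclNorm_sq_pos {x : n → ℂ} (hx : x ≠ 0) : 0 < euclNorm x ^ 2 :=
  pow_pos (norm_pos_iff.2 fun h => hx ((WithLp.toLp_eq_zero 2).1 h)) 2

theorem norm_star_dotProduct_le (x y : n → ℂ) :
    ‖star y ⬝ᵥ x‖ ≤ euclNorm x * euclNorm y := by
  have h := norm_inner_le_norm (𝕜 := ℂ) (WithLp.toLp 2 y) (WithLp.toLp 2 x)
  rw [EuclideanSpace.inner_eq_star_dotProduct, dotProduct_comm, mul_comm] at h
  exact h

theorem euclNorm_mulVec_sq (A : Matrix m n ℂ) (x : n → ℂ) :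
    ((euclNorm (A *ᵥ x) ^ 2 : ℝ) : ℂ) = star x ⬝ᵥ ((Aᴴ * A) *ᵥ x) := by
  rw [← star_dotProduct_self, star_mulVec, ← dotProduct_mulVec, mulVec_mulVec]

theorem euclNorm_mulVec_le [DecidableEq n] (A : Matrix m n ℂ) (x : n → ℂ) :
    euclNorm (A *ᵥ x) ≤ ‖A‖ * euclNorm x :=
  l2_opNorm_mulVec A (WithLp.toLp 2 x)

variable [DecidableEq m] [DecidableEq n]

theorem traceNorm_nonneg (X : Matrix n n ℂ) : 0 ≤ traceNorm X :=
  Finset.sum_nonneg fun _ _ => Real.sqrt_nonneg _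

theorem norm_le_one_of_mem_unitaryGroup {W : Matrix n n ℂ} (hW : W ∈ unitaryGroup n ℂ) :
    ‖W‖ ≤ 1 := by
  cases isEmpty_or_nonempty n
  · rw [Subsingleton.elim W 0, norm_zero]
    exact zero_le_one
  · exact (CStarRing.norm_of_mem_unitary hW).le

theorem sum_vecMulVec_orthonormalBasis (b : OrthonormalBasis n ℂ (EuclideanSpace ℂ n)) :
    ∑ i, vecMulVec (b i).ofLp (star (b i).ofLp) = (1 : Matrix n n ℂ) := by
  refine Matrix.ext_of_mulVec_single fun j => ?_
  have h := congrArg WithLp.ofLp (b.sum_repr' (EuclideanSpace.single j 1))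
  rw [one_mulVec, Matrix.sum_mulVec]
  simp only [vecMulVec_mulVec]
  simpa [EuclideanSpace.inner_eq_star_dotProduct, dotProduct_comm] using h

/-- The singular value decomposition of a square matrix. -/
theorem exists_sum_vecMulVec_eq (X : Matrix n n ℂ) :
    ∃ x y : n → n → ℂ, X = ∑ i, vecMulVec (x i) (star (y i)) ∧
      ∑ i, euclNorm (x i) * euclNorm (y i) = traceNorm X := by
  set hX := isHermitian_conjTranspose_mul_self X
  refine ⟨fun i => X *ᵥ (hX.eigenvectorBasis i).ofLp, fun i => (hX.eigenvectorBasis i).ofLp,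
    ?_, Finset.sum_congr rfl fun i _ => ?_⟩
  · conv_lhs => rw [← mul_one X, ← sum_vecMulVec_orthonormalBasis hX.eigenvectorBasis,
      Matrix.mul_sum]
    simp only [mul_vecMulVec]
  · have h1 : euclNorm (hX.eigenvectorBasis i).ofLp = 1 := hX.eigenvectorBasis.norm_eq_one i
    have h2 : euclNorm (X *ᵥ (hX.eigenvectorBasis i).ofLp) ^ 2 = hX.eigenvalues i := by
      have h := euclNorm_mulVec_sq X (hX.eigenvectorBasis i).ofLp
      rw [hX.mulVec_eigenvectorBasis, dotProduct_smul, star_dotProduct_self, h1] at h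
      refine Complex.ofReal_injective (h.trans ?_)
      simp
    rw [h1, mul_one, ← h2, Real.sqrt_sq (euclNorm_nonneg _)]

theorem norm_trace_mul_le (W X : Matrix n n ℂ) : ‖(W * X).trace‖ ≤ ‖W‖ * traceNorm X := by
  obtain ⟨x, y, hX, hn⟩ := exists_sum_vecMulVec_eq X
  rw [← hn]
  conv_lhs => rw [hX, Matrix.mul_sum, trace_sum]
  rw [Finset.mul_sum]
  refine norm_sum_le_of_le _ fun i _ => ?_
  rw [mul_vecMulVec, trace_vecMulVec, dotProduct_comm, ← mul_assoc]
  exact (norm_star_dotProduct_le _ _).trans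
    (mul_le_mul_of_nonneg_right (euclNorm_mulVec_le _ _) (euclNorm_nonneg _))

theorem exists_conjTranspose_mul_self_eq (X : Matrix n n ℂ) :
    ∃ (V : Matrix n n ℂ) (s : n → ℝ), Vᴴ * V = 1 ∧ ‖V‖ ≤ 1 ∧ ∑ i, s i = traceNorm X ∧
      Xᴴ * X = V * diagonal (fun i => (s i * s i : ℂ)) * Vᴴ := by
  have hX := isHermitian_conjTranspose_mul_self X
  refine ⟨hX.eigenvectorUnitary, fun i => √(hX.eigenvalues i),
    mem_unitaryGroup_iff'.1 hX.eigenvectorUnitary.2,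
    norm_le_one_of_mem_unitaryGroup hX.eigenvectorUnitary.2, rfl, ?_⟩
  have h := hX.spectral_theorem
  rw [Unitary.conjStarAlgAut_apply] at h
  refine h.trans ?_
  congr 3
  ext i
  simp only [Function.comp_apply]
  rw [← Complex.ofReal_mul, Real.mul_self_sqrt (eigenvalues_conjTranspose_mul_self_nonneg X i)]
  rfl

theorem exists_trace_mul_eq_traceNorm (X : Matrix n n ℂ) :
    ∃ W : Matrix n n ℂ, ‖W‖ ≤ 1 ∧ (W * X).trace = traceNorm X := by
  obtain ⟨V, s, hVV, hVn, hsum, hspec⟩ := exists_conjTranspose_mul_self_eq X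
  -- Since `0⁻¹ = 0`, `V * D * Vᴴ` is the pseudo-inverse of `|X|`. The witness is thus the adjoint
  -- of the partial isometry in the polar decomposition, and its product with its own adjoint is a
  -- projection.
  set D : Matrix n n ℂ := diagonal fun i => ((s i)⁻¹ : ℂ) with hD
  have hDD : Dᴴ = D := by
    rw [hD, diagonal_conjTranspose]
    congr 1
    ext i
    simp
  refine ⟨V * D * Vᴴ * Xᴴ, ?_, ?_⟩
  · have h1 : (V * D * Vᴴ * Xᴴ) * (V * D * Vᴴ * Xᴴ)ᴴ =
        V * diagonal (fun i => ((s i : ℂ)⁻¹ * (s i * s i) * (s i : ℂ)⁻¹)) * Vᴴ := by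
      calc _ = V * D * Vᴴ * (Xᴴ * X) * V * D * Vᴴ := by
            simp only [conjTranspose_mul, conjTranspose_conjTranspose, hDD, Matrix.mul_assoc]
        _ = V * D * (Vᴴ * V) * diagonal (fun i => (s i * s i : ℂ)) * (Vᴴ * V) * D * Vᴴ := by
            rw [hspec]
            simp only [Matrix.mul_assoc]
        _ = _ := by
            rw [hVV, mul_one, mul_one, hD, Matrix.mul_assoc V, Matrix.mul_assoc V,
              diagonal_mul_diagonal, diagonal_mul_diagonal]
    have h2 : ‖diagonal (fun i => ((s i : ℂ)⁻¹ * (s i * s i) * (s i : ℂ)⁻¹))‖ ≤ 1 := by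
      rw [l2_opNorm_diagonal, pi_norm_le_iff_of_nonneg zero_le_one]
      intro i
      by_cases h : s i = 0
      · simp [h]
      · have : (s i : ℂ) ≠ 0 := by exact_mod_cast h
        rw [inv_mul_cancel_left₀ this, mul_inv_cancel₀ this, norm_one]
    have h3 : ‖(V * D * Vᴴ * Xᴴ) * (V * D * Vᴴ * Xᴴ)ᴴ‖ ≤ 1 := by
      rw [h1]
      refine (l2_opNorm_mul _ _).trans ?_
      refine (mul_le_mul_of_nonneg_right (l2_opNorm_mul _ _) (norm_nonneg _)).trans ?_
      rw [l2_opNorm_conjTranspose]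
      exact mul_le_one₀ (mul_le_one₀ hVn (norm_nonneg _) h2) (norm_nonneg _) hVn
    have h4 := CStarRing.norm_self_mul_star (x := V * D * Vᴴ * Xᴴ)
    rw [star_eq_conjTranspose] at h4
    rw [h4] at h3
    nlinarith [norm_nonneg (V * D * Vᴴ * Xᴴ)]
  · calc (V * D * Vᴴ * Xᴴ * X).trace = (V * D * (Vᴴ * (Xᴴ * X))).trace := by
          simp only [Matrix.mul_assoc]
      _ = (V * D * (Vᴴ * V) * diagonal (fun i => (s i * s i : ℂ)) * Vᴴ).trace := by
          rw [hspec]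
          simp only [Matrix.mul_assoc]
      _ = (D * diagonal (fun i => (s i * s i : ℂ))).trace := by
          rw [trace_mul_comm, hVV, mul_one, Matrix.mul_assoc V, ← Matrix.mul_assoc, hVV, one_mul]
      _ = _ := by
          rw [hD, diagonal_mul_diagonal, trace_diagonal, ← hsum, Complex.ofReal_sum]
          refine Finset.sum_congr rfl fun i _ => ?_
          by_cases h : s i = 0
          · simp [h]
          · have : (s i : ℂ) ≠ 0 := by exact_mod_cast h
            rw [inv_mul_cancel_left₀ this]

theorem traceNorm_le_of_forall {X : Matrix n n ℂ} {r : ℝ}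
    (h : ∀ W : Matrix n n ℂ, ‖W‖ ≤ 1 → ‖(W * X).trace‖ ≤ r) : traceNorm X ≤ r := by
  obtain ⟨W, hW, hWX⟩ := exists_trace_mul_eq_traceNorm X
  have := h W hW
  rwa [hWX, Complex.norm_real, Real.norm_of_nonneg (traceNorm_nonneg X)] at this

theorem norm_trace_mul_le_traceNorm {W : Matrix n n ℂ} (hW : ‖W‖ ≤ 1) (X : Matrix n n ℂ) :
    ‖(W * X).trace‖ ≤ traceNorm X :=
  (norm_trace_mul_le W X).trans (mul_le_of_le_one_left (traceNorm_nonneg X) hW)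

theorem traceNorm_sum_le {ι : Type*} (s : Finset ι) (X : ι → Matrix n n ℂ) :
    traceNorm (∑ i ∈ s, X i) ≤ ∑ i ∈ s, traceNorm (X i) := by
  refine traceNorm_le_of_forall fun W hW => ?_
  rw [Matrix.mul_sum, trace_sum]
  exact norm_sum_le_of_le _ fun i _ => norm_trace_mul_le_traceNorm hW _

theorem traceNorm_sub_le (X Y : Matrix n n ℂ) :
    traceNorm (X - Y) ≤ traceNorm X + traceNorm Y := by
  refine traceNorm_le_of_forall fun W hW => ?_
  rw [Matrix.mul_sub, trace_sub]
  exact (norm_sub_le _ _).trans (add_le_add (norm_trace_mul_le_traceNorm hW _)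
    (norm_trace_mul_le_traceNorm hW _))

theorem traceNorm_zero : traceNorm (0 : Matrix n n ℂ) = 0 :=
  le_antisymm (traceNorm_le_of_forall fun W _ => by simp) (traceNorm_nonneg _)

theorem traceNorm_neg (X : Matrix n n ℂ) : traceNorm (-X) = traceNorm X := by
  simp [traceNorm]

theorem traceNorm_vecMulVec_le (x y : n → ℂ) :
    traceNorm (vecMulVec x (star y)) ≤ euclNorm x * euclNorm y := by
  refine traceNorm_le_of_forall fun W hW => ?_
  rw [mul_vecMulVec, trace_vecMulVec, dotProduct_comm]
  refine (norm_star_dotProduct_le _ _).trans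
    (mul_le_mul_of_nonneg_right ?_ (euclNorm_nonneg _))
  exact (euclNorm_mulVec_le _ _).trans (mul_le_of_le_one_left (euclNorm_nonneg x) hW)

/-- A linear map is bounded for the trace norm by its bound on matrices of rank one. -/
theorem traceNorm_map_le (Φ : Matrix m m ℂ →ₗ[ℂ] Matrix n n ℂ) {C : ℝ}
    (h : ∀ x y, traceNorm (Φ (vecMulVec x (star y))) ≤ C * (euclNorm x * euclNorm y))
    (X : Matrix m m ℂ) : traceNorm (Φ X) ≤ C * traceNorm X := by
  obtain ⟨x, y, hX, hn⟩ := exists_sum_vecMulVec_eq X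
  rw [← hn, Finset.mul_sum]
  conv_lhs => rw [hX, map_sum]
  exact (traceNorm_sum_le _ _).trans (Finset.sum_le_sum fun i _ => h _ _)

theorem traceNorm_unitary_conj_le {W : Matrix n n ℂ} (hW : W ∈ unitaryGroup n ℂ)
    (X : Matrix n n ℂ) : traceNorm (W * X * Wᴴ) ≤ traceNorm X := by
  refine traceNorm_le_of_forall fun Z hZ => ?_
  rw [← Matrix.mul_assoc, ← Matrix.mul_assoc, trace_mul_comm, ← Matrix.mul_assoc,
    ← Matrix.mul_assoc]
  refine norm_trace_mul_le_traceNorm ?_ X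
  have hW1 := norm_le_one_of_mem_unitaryGroup hW
  refine (l2_opNorm_mul _ _).trans (mul_le_one₀ ((l2_opNorm_mul _ _).trans ?_) (norm_nonneg _) hW1)
  rw [l2_opNorm_conjTranspose]
  exact mul_le_one₀ hW1 (norm_nonneg _) hZ

/-- For a Hermitian matrix with positive part of trace `a` and negative part of trace `b`, this is
`(a + b) ^ 2 + (a - b) ^ 2 = 2 * (a ^ 2 + b ^ 2)` together with `tr Y ^ 2 ≤ a ^ 2 + b ^ 2`. -/
theorem two_mul_trace_sq_le {Y : Matrix n n ℂ} (hY : Y.IsHermitian) :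
    2 * (Y * Y).trace.re ≤ traceNorm Y ^ 2 + Y.trace.re ^ 2 := by
  set V := (hY.eigenvectorUnitary : Matrix n n ℂ) with hV
  have hVV : Vᴴ * V = 1 := (mem_unitaryGroup_iff'.1 hY.eigenvectorUnitary.2)
  have hVn : ‖V‖ ≤ 1 := norm_le_one_of_mem_unitaryGroup hY.eigenvectorUnitary.2
  have hspec : Y = V * diagonal (fun i => (hY.eigenvalues i : ℂ)) * Vᴴ := by
    have h := hY.spectral_theorem
    rw [Unitary.conjStarAlgAut_apply] at h
    exact h
  set l : n → ℝ := hY.eigenvalues with hl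
  have htr : ∀ f : n → ℝ, (V * diagonal (fun i => (f i : ℂ)) * Vᴴ * Y).trace.re
      = ∑ i, f i * l i := by
    intro f
    have h1 : V * diagonal (fun i => (f i : ℂ)) * Vᴴ * Y =
        V * (diagonal (fun i => (f i : ℂ)) * (Vᴴ * V) * diagonal (fun i => (l i : ℂ))) * Vᴴ := by
      conv_lhs => rw [hspec]
      simp only [Matrix.mul_assoc]
    rw [h1, trace_mul_comm, ← Matrix.mul_assoc, hVV, mul_one, one_mul, diagonal_mul_diagonal,
      trace_diagonal, Complex.re_sum]
    exact Finset.sum_congr rfl fun i _ => by simp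
  have h1 : Y.trace.re = ∑ i, l i := by
    have h := hY.trace_eq_sum_eigenvalues
    rw [h, Complex.re_sum]
    rfl
  have h2 : (Y * Y).trace.re = ∑ i, l i * l i := by
    conv_lhs => enter [1, 1, 1]; rw [hspec]
    exact htr l
  have h3 : ∑ i, |l i| ≤ traceNorm Y := by
    -- The sign of `Y`, as a contraction, detects the sum of the absolute values of the eigenvalues.
    set f : n → ℝ := fun i => if 0 ≤ l i then 1 else -1
    have hf : ‖V * diagonal (fun i => (f i : ℂ)) * Vᴴ‖ ≤ 1 := by
      refine (l2_opNorm_mul _ _).trans ?_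
      rw [l2_opNorm_conjTranspose]
      refine mul_le_one₀ ((l2_opNorm_mul _ _).trans (mul_le_one₀ hVn (norm_nonneg _) ?_))
        (norm_nonneg _) hVn
      rw [l2_opNorm_diagonal, pi_norm_le_iff_of_nonneg zero_le_one]
      intro i
      simp only [f]
      split_ifs <;> simp
    have h := (Complex.re_le_norm _).trans (norm_trace_mul_le_traceNorm hf Y)
    rw [htr] at h
    refine le_trans (le_of_eq (Finset.sum_congr rfl fun i _ => ?_)) h
    simp only [f]
    split_ifs with h0
    · rw [abs_of_nonneg h0, one_mul]
    · rw [abs_of_neg (not_le.1 h0), neg_one_mul]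
  have h4 : (∑ i, |l i|) ^ 2 ≤ traceNorm Y ^ 2 :=
    pow_le_pow_left₀ (Finset.sum_nonneg fun i _ => abs_nonneg _) h3 2
  have h5 : ∀ g : n → ℝ, (∀ i, 0 ≤ g i) → ∑ i, g i ^ 2 ≤ (∑ i, g i) ^ 2 := fun g hg =>
    Finset.sum_sq_le_sq_sum_of_nonneg fun i _ => hg i
  -- The summands of `h6` and `h7` are twice the positive and negative parts of the eigenvalues.
  have h6 := h5 (fun i => |l i| + l i) fun i => by linarith [neg_abs_le (l i)]
  have h7 := h5 (fun i => |l i| - l i) fun i => by linarith [le_abs_self (l i)]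
  rw [Finset.sum_add_distrib] at h6
  rw [Finset.sum_sub_distrib] at h7
  have h8 : ∑ i, (|l i| + l i) ^ 2 + ∑ i, (|l i| - l i) ^ 2 = 4 * ∑ i, l i * l i := by
    rw [← Finset.sum_add_distrib, Finset.mul_sum]
    refine Finset.sum_congr rfl fun i _ => ?_
    linear_combination 2 * abs_mul_abs_self (l i)
  rw [h1, h2]
  linarith

/-- Contractions optimal for the single blocks assemble into one block diagonal contraction, which
pairs only with the diagonal blocks of `M`. Off-diagonal blocks are therefore unrestricted. -/
theorem sum_traceNorm_le_traceNorm_blockDiagonal {k : Type*} [Fintype k] [DecidableEq k]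
    (Y : n → Matrix k k ℂ) (M : Matrix (n × k) (n × k) ℂ)
    (hM : ∀ i a b, M (i, a) (i, b) = Y i a b) : ∑ i, traceNorm (Y i) ≤ traceNorm M := by
  choose W hW hWY using fun i => exists_trace_mul_eq_traceNorm (Y i)
  set Z : Matrix (n × k) (n × k) ℂ :=
    Matrix.of fun p q => if p.1 = q.1 then W p.1 p.2 q.2 else 0 with hZ
  have hZn : ‖Z‖ ≤ 1 := by
    rw [l2_opNorm_def]
    refine ContinuousLinearMap.opNorm_le_bound _ zero_le_one fun x => ?_
    rw [one_mul]
    refine le_of_sq_le_sq ?_ (norm_nonneg _)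
    have e : ∀ p, (Z *ᵥ x.ofLp) p = (W p.1 *ᵥ fun a => x.ofLp (p.1, a)) p.2 := by
      intro p
      simp [Z, mulVec, dotProduct, Fintype.sum_prod_type, ite_mul]
    change euclNorm (Z *ᵥ x.ofLp) ^ 2 ≤ euclNorm x.ofLp ^ 2
    rw [euclNorm_sq, euclNorm_sq, Fintype.sum_prod_type, Fintype.sum_prod_type]
    refine Finset.sum_le_sum fun i _ => ?_
    simp only [e]
    rw [← euclNorm_sq, ← euclNorm_sq (fun a => x.ofLp (i, a))]
    refine pow_le_pow_left₀ (euclNorm_nonneg _) ?_ 2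
    exact (euclNorm_mulVec_le _ _).trans (mul_le_of_le_one_left (euclNorm_nonneg _) (hW i))
  have h := norm_trace_mul_le_traceNorm hZn M
  have ht : (Z * M).trace = ((∑ i, traceNorm (Y i) : ℝ) : ℂ) := by
    rw [Complex.ofReal_sum]
    simp only [← hWY]
    simp [Z, trace, Matrix.mul_apply, Fintype.sum_prod_type, ite_mul, hM]
  rw [ht, Complex.norm_real] at h
  exact (le_abs_self _).trans h

end TraceNorm

/-! ### Diamond distances of unitary and of measurement channels. -/

section Channels

open Matrix
open scoped Matrix.Norms.L2Operator

variable {m n k : Type*}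

theorem ampliation_sub (Φ Ψ : Matrix m m ℂ →ₗ[ℂ] Matrix n n ℂ) (X : Matrix (m × k) (m × k) ℂ) :
    ampliation k (Φ - Ψ) X = ampliation k Φ X - ampliation k Ψ X := rfl

variable [Fintype n] [Fintype k] [DecidableEq k]

theorem kronecker_one_mulVec (A : Matrix m n ℂ) (x : n × k → ℂ) (p : m × k) :
    ((A ⊗ₖ (1 : Matrix k k ℂ)) *ᵥ x) p = (A *ᵥ fun i => x (i, p.2)) p.1 := by
  simp [mulVec, dotProduct, Fintype.sum_prod_type, one_apply]

theorem kronecker_one_conj_apply (A : Matrix n n ℂ) (X : Matrix (n × k) (n × k) ℂ)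
    (p q : n × k) :
    ((A ⊗ₖ (1 : Matrix k k ℂ)) * X * (A ⊗ₖ (1 : Matrix k k ℂ))ᴴ) p q =
      (A * (Matrix.of fun i j => X (i, p.2) (j, q.2)) * Aᴴ) p.1 q.1 := by
  simp [Matrix.mul_apply, Fintype.sum_prod_type, one_apply, apply_ite]

theorem ampliation_unitaryChannel (U : Matrix n n ℂ) (X : Matrix (n × k) (n × k) ℂ) :
    ampliation k (unitaryChannel U) X =
      (U ⊗ₖ (1 : Matrix k k ℂ)) * X * (U ⊗ₖ (1 : Matrix k k ℂ))ᴴ := by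
  ext p q
  rw [kronecker_one_conj_apply]
  rfl

theorem euclNorm_real_smul_sub_sq (a b : ℝ) (x y : n → ℂ) :
    euclNorm ((a : ℂ) • x - (b : ℂ) • y) ^ 2 =
      a ^ 2 * euclNorm x ^ 2 + b ^ 2 * euclNorm y ^ 2 - 2 * a * b * (star y ⬝ᵥ x).re := by
  simp only [euclNorm_sq, dotProduct, Complex.re_sum, Finset.mul_sum]
  rw [← Finset.sum_add_distrib, ← Finset.sum_sub_distrib]
  refine Finset.sum_congr rfl fun i _ => ?_
  simp only [← Complex.normSq_eq_norm_sq, Complex.normSq_apply]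
  simp
  ring

theorem trace_vecMulVec_sub_sq (x y : n → ℂ) :
    ((vecMulVec x (star x) - vecMulVec y (star y)) *
      (vecMulVec x (star x) - vecMulVec y (star y))).trace.re =
      (euclNorm x ^ 2) ^ 2 + (euclNorm y ^ 2) ^ 2 - 2 * ‖star y ⬝ᵥ x‖ ^ 2 := by
  have h : star x ⬝ᵥ y = star (star y ⬝ᵥ x) := by
    rw [star_dotProduct]
  have h1 : ((vecMulVec x (star x) - vecMulVec y (star y)) *
      (vecMulVec x (star x) - vecMulVec y (star y))).trace =
      (star x ⬝ᵥ x) * (star x ⬝ᵥ x) + (star y ⬝ᵥ y) * (star y ⬝ᵥ y)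
        - 2 * ((starRingEnd ℂ) (star y ⬝ᵥ x) * (star y ⬝ᵥ x)) := by
    rw [Matrix.mul_sub, Matrix.sub_mul, Matrix.sub_mul]
    simp only [vecMulVec_mul_vecMulVec, trace_sub, trace_vecMulVec,
      vecMulVec_smul, trace_smul, dotProduct_comm x (star x), dotProduct_comm y (star y),
      dotProduct_comm x (star y), dotProduct_comm y (star x), h, smul_eq_mul]
    simp only [RCLike.star_def]
    ring
  rw [h1, star_dotProduct_self, star_dotProduct_self, Complex.conj_mul']
  norm_cast
  ring

variable [Fintype m] [DecidableEq m] [DecidableEq n]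

theorem traceNorm_unitary_conj {W : Matrix n n ℂ} (hW : W ∈ unitaryGroup n ℂ)
    (X : Matrix n n ℂ) : traceNorm (W * X * Wᴴ) = traceNorm X := by
  refine le_antisymm (traceNorm_unitary_conj_le hW X) ?_
  have h := traceNorm_unitary_conj_le (Unitary.star_mem hW) (W * X * Wᴴ)
  have h2 : Wᴴ * W = 1 := mem_unitaryGroup_iff'.1 hW
  rw [star_eq_conjTranspose, conjTranspose_conjTranspose] at h
  have h3 : Wᴴ * (W * X * Wᴴ) * W = Wᴴ * W * X * (Wᴴ * W) := by simp only [Matrix.mul_assoc]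
  rwa [h3, h2, one_mul, mul_one] at h

theorem diamondNorm_nonneg (Φ : Matrix m m ℂ →ₗ[ℂ] Matrix n n ℂ) : 0 ≤ diamondNorm Φ :=
  Real.sSup_nonneg fun _ ⟨_, _, h⟩ => h ▸ traceNorm_nonneg _

theorem diamondNorm_le (Φ : Matrix m m ℂ →ₗ[ℂ] Matrix n n ℂ) {C : ℝ} (hC : 0 ≤ C)
    (h : ∀ X, traceNorm X = 1 → traceNorm (ampliation m Φ X) ≤ C) : diamondNorm Φ ≤ C :=
  Real.sSup_le (by rintro _ ⟨X, hX, rfl⟩; exact h X hX) hC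

theorem traceNorm_ampliation_le [Nonempty m] (Φ : Matrix m m ℂ →ₗ[ℂ] Matrix n n ℂ)
    {X : Matrix (m × m) (m × m) ℂ} (hX : traceNorm X = 1) :
    traceNorm (ampliation m Φ X) ≤ diamondNorm Φ :=
  (diamondNorm_isGreatest Φ).2 ⟨X, hX, rfl⟩

theorem diamondNorm_zero : diamondNorm (0 : Matrix m m ℂ →ₗ[ℂ] Matrix n n ℂ) = 0 := by
  refine le_antisymm (diamondNorm_le _ le_rfl fun X _ => ?_) (diamondNorm_nonneg _)
  have : ampliation m (0 : Matrix m m ℂ →ₗ[ℂ] Matrix n n ℂ) X = 0 := rfl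
  rw [this, traceNorm_zero]

theorem measurementChannel_apply (U ρ : Matrix n n ℂ) :
    measurementChannel U ρ = diagonal fun i => (Uᴴ * ρ * U) i i := by
  have h : ∀ i, star (U.col i) ⬝ᵥ (ρ *ᵥ U.col i) = (Uᴴ * ρ * U) i i := by
    intro i
    rw [Matrix.mul_assoc]
    rfl
  change ∑ i, (star (U.col i) ⬝ᵥ (ρ *ᵥ U.col i)) • Matrix.single i i (1 : ℂ) = _
  simp only [h]
  ext a b
  simp [Matrix.sum_apply, Matrix.single_apply, diagonal_apply, ite_and]

/-- Removal of the blocks off the diagonal. -/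
def blockDephase (n k : Type*) [DecidableEq n] :
    Matrix (n × k) (n × k) ℂ →ₗ[ℂ] Matrix (n × k) (n × k) ℂ where
  toFun X := Matrix.of fun p q => if p.1 = q.1 then X p q else 0
  map_add' X Y := by
    ext p q
    by_cases h : p.1 = q.1 <;> simp [h]
  map_smul' c X := by
    ext p q
    by_cases h : p.1 = q.1 <;> simp [h]

theorem ampliation_measurementChannel (U : Matrix n n ℂ) (X : Matrix (n × k) (n × k) ℂ) :
    ampliation k (measurementChannel U) X =
      blockDephase n k ((Uᴴ ⊗ₖ (1 : Matrix k k ℂ)) * X * (Uᴴ ⊗ₖ (1 : Matrix k k ℂ))ᴴ) := by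
  ext p q
  change measurementChannel U _ p.1 q.1 = if p.1 = q.1 then _ else _
  rw [measurementChannel_apply, kronecker_one_conj_apply, conjTranspose_conjTranspose,
    diagonal_apply]
  split_ifs with h
  · rw [h]
  · rfl

/-- On a rank-one matrix only the products of matching blocks of the two vectors survive;
Cauchy-Schwarz over the blocks bounds the sum of their norms. -/
theorem traceNorm_blockDephase_le (X : Matrix (n × k) (n × k) ℂ) :
    traceNorm (blockDephase n k X) ≤ traceNorm X := by
  rw [← one_mul (traceNorm X)]
  refine traceNorm_map_le _ (fun x y => ?_) X
  set c : n → (n × k → ℂ) → n × k → ℂ := fun i x p => if p.1 = i then x p else 0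
  have h1 : blockDephase n k (vecMulVec x (star y)) =
      ∑ i, vecMulVec (c i x) (star (c i y)) := by
    ext p q
    change (if p.1 = q.1 then _ else _) = _
    rw [Matrix.sum_apply]
    by_cases h : p.1 = q.1
    · simp [vecMulVec_apply, c, h, apply_ite]
    · simp [vecMulVec_apply, c, h, apply_ite]
  have h2 : ∀ x, ∑ i, euclNorm (c i x) ^ 2 = euclNorm x ^ 2 := by
    intro x
    simp only [euclNorm_sq]
    rw [Finset.sum_comm]
    exact Finset.sum_congr rfl fun p _ => by simp [c, apply_ite]
  rw [h1, one_mul]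
  refine (traceNorm_sum_le _ _).trans ((Finset.sum_le_sum fun i _ =>
    traceNorm_vecMulVec_le _ _).trans ?_)
  refine abs_le_of_sq_le_sq' ?_ (mul_nonneg (euclNorm_nonneg x) (euclNorm_nonneg y)) |>.2
  rw [mul_pow, ← h2 x, ← h2 y]
  exact Finset.sum_mul_sq_le_sq_mul_sq _ _ _

theorem kronecker_one_mem_unitaryGroup {U : Matrix n n ℂ} (hU : U ∈ unitaryGroup n ℂ) :
    U ⊗ₖ (1 : Matrix k k ℂ) ∈ unitaryGroup (n × k) ℂ :=
  kronecker_mem_unitary hU (one_mem _)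

theorem measurementChannel_mul_diagonal (U : Matrix n n ℂ) {e : n → ℂ} (he : ∀ i, ‖e i‖ = 1) :
    measurementChannel (U * diagonal e) = measurementChannel U := by
  ext1 ρ
  rw [measurementChannel_apply, measurementChannel_apply]
  congr 1
  ext i
  have h1 : (U * diagonal e)ᴴ * ρ * (U * diagonal e) =
      diagonal (star e) * (Uᴴ * ρ * U) * diagonal e := by
    rw [conjTranspose_mul, diagonal_conjTranspose]
    simp only [Matrix.mul_assoc]
  rw [h1, mul_diagonal, diagonal_mul, mul_right_comm]
  have h2 : star e i * e i = 1 := by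
    have := Complex.conj_mul' (e i)
    rw [he i] at this
    simpa using this
  rw [h2, one_mul]

/-- Dephasing is dropped at no gain in trace norm. What remains compares conjugations by `Gᴴ` and
`Vᴴ`; the input `Vᴴ X V`, followed by conjugation with `Gᴴ`, turns this into the negated difference
for `G` and `V`. -/
theorem diamondNorm_measurementChannel_sub_le [Nonempty n] {G V : Matrix n n ℂ}
    (hG : G ∈ unitaryGroup n ℂ) (hV : V ∈ unitaryGroup n ℂ) :
    diamondNorm (measurementChannel G - measurementChannel V) ≤
      diamondNorm (unitaryChannel G - unitaryChannel V) := by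
  refine diamondNorm_le _ (diamondNorm_nonneg _) fun X hX => ?_
  set G' : Matrix (n × n) (n × n) ℂ := G ⊗ₖ (1 : Matrix n n ℂ) with hG'
  set V' : Matrix (n × n) (n × n) ℂ := V ⊗ₖ (1 : Matrix n n ℂ) with hV'
  have uG : G' ∈ unitaryGroup (n × n) ℂ := kronecker_one_mem_unitaryGroup hG
  have uV : V' ∈ unitaryGroup (n × n) ℂ := kronecker_one_mem_unitaryGroup hV
  have eG : Gᴴ ⊗ₖ (1 : Matrix n n ℂ) = G'ᴴ := by
    rw [hG', conjTranspose_kronecker, conjTranspose_one]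
  have eV : Vᴴ ⊗ₖ (1 : Matrix n n ℂ) = V'ᴴ := by
    rw [hV', conjTranspose_kronecker, conjTranspose_one]
  have GG : G'ᴴ * G' = 1 := mem_unitaryGroup_iff'.1 uG
  have VV : V' * V'ᴴ = 1 := mem_unitaryGroup_iff.1 uV
  set Y := V'ᴴ * X * V'ᴴᴴ with hYdef
  have hY : traceNorm Y = 1 := (traceNorm_unitary_conj (Unitary.star_mem uV) X).trans hX
  rw [ampliation_sub, ampliation_measurementChannel, ampliation_measurementChannel, eG, eV,
    ← map_sub]
  refine (traceNorm_blockDephase_le _).trans (le_trans (le_of_eq ?_)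
    (traceNorm_ampliation_le (unitaryChannel G - unitaryChannel V) hY))
  have h1 : V' * Y * V'ᴴ = X := by
    have : V' * Y * V'ᴴ = (V' * V'ᴴ) * X * (V' * V'ᴴ) := by
      simp only [hYdef, conjTranspose_conjTranspose, Matrix.mul_assoc]
    rw [this, VV, one_mul, mul_one]
  have h2 : G'ᴴ * (G' * Y * G'ᴴ) * G'ᴴᴴ = Y := by
    have : G'ᴴ * (G' * Y * G'ᴴ) * G'ᴴᴴ = (G'ᴴ * G') * Y * (G'ᴴ * G') := by
      simp only [conjTranspose_conjTranspose, Matrix.mul_assoc]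
    rw [this, GG, one_mul, mul_one]
  have h3 : G'ᴴ * X * G'ᴴᴴ - V'ᴴ * X * V'ᴴᴴ =
      -(G'ᴴ * ampliation n (unitaryChannel G - unitaryChannel V) Y * G'ᴴᴴ) := by
    rw [ampliation_sub, ampliation_unitaryChannel, ampliation_unitaryChannel, ← hG', ← hV', h1,
      Matrix.mul_sub, Matrix.sub_mul, neg_sub, h2]
  rw [h3, traceNorm_neg]
  exact traceNorm_unitary_conj (Unitary.star_mem uG) _

theorem diamondNorm_unitaryChannel_sub_le_two {G V : Matrix n n ℂ}
    (hG : G ∈ unitaryGroup n ℂ) (hV : V ∈ unitaryGroup n ℂ) :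
    diamondNorm (unitaryChannel G - unitaryChannel V) ≤ 2 := by
  refine diamondNorm_le _ zero_le_two fun X hX => ?_
  rw [ampliation_sub, ampliation_unitaryChannel, ampliation_unitaryChannel]
  refine (traceNorm_sub_le _ _).trans ?_
  rw [traceNorm_unitary_conj (kronecker_one_mem_unitaryGroup hG),
    traceNorm_unitary_conj (kronecker_one_mem_unitaryGroup hV), hX]
  norm_num

theorem euclNorm_unitary_mulVec {W : Matrix n n ℂ} (hW : W ∈ unitaryGroup n ℂ) (x : n → ℂ) :
    euclNorm (W *ᵥ x) ^ 2 = euclNorm x ^ 2 := by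
  have h := euclNorm_mulVec_sq W x
  have h2 : Wᴴ * W = 1 := mem_unitaryGroup_iff'.1 hW
  rw [h2, one_mulVec, star_dotProduct_self] at h
  exact Complex.ofReal_injective h

/-- On a rank-one input the output is a difference of two rank-one matrices. A hyperbolic rotation
of the pair `(G x, V x)` leaves this difference unchanged but shortens the vectors, so that the
plain triangle inequality becomes sharp enough. Strictness of `t < 1` keeps the rotation finite. -/
theorem diamondNorm_unitaryChannel_sub_le {G V : Matrix n n ℂ}
    (hG : G ∈ unitaryGroup n ℂ) (hV : V ∈ unitaryGroup n ℂ) {t : ℝ} (ht0 : 0 ≤ t) (ht1 : t < 1)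
    (h : ∀ x, t * euclNorm x ^ 2 ≤ (star x ⬝ᵥ ((Vᴴ * G) *ᵥ x)).re) :
    diamondNorm (unitaryChannel G - unitaryChannel V) ≤ 2 * √(1 - t ^ 2) := by
  set s := √(1 - t ^ 2) with hs
  have hs2 : s ^ 2 = 1 - t ^ 2 := Real.sq_sqrt (by nlinarith)
  have hs0 : 0 < s := Real.sqrt_pos.2 (by nlinarith)
  have hs1 : s ≤ 1 := by nlinarith [sq_nonneg t]
  have hsi : 1 ≤ s⁻¹ := (one_le_inv₀ hs0).2 hs1
  -- These are `cosh θ` and `sinh θ` with `tanh (2 * θ) = t`, the angle minimizing `2 * cosh (2 * θ)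
  -- - 2 * t * sinh (2 * θ)`; the minimum is `2 * s`.
  set u := √((s⁻¹ + 1) / 2) with hu
  set v := √((s⁻¹ - 1) / 2) with hv
  have hu2 : u ^ 2 = (s⁻¹ + 1) / 2 := Real.sq_sqrt (by linarith)
  have hv2 : v ^ 2 = (s⁻¹ - 1) / 2 := Real.sq_sqrt (by linarith)
  have huv : 2 * (u * v) = t / s := by
    rw [hu, hv, ← Real.sqrt_mul (by linarith)]
    have : (s⁻¹ + 1) / 2 * ((s⁻¹ - 1) / 2) = (t / s / 2) ^ 2 := by
      field_simp
      linarith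
    rw [this, Real.sqrt_sq (by positivity)]
    ring
  set G' : Matrix (n × n) (n × n) ℂ := G ⊗ₖ (1 : Matrix n n ℂ) with hG'
  set V' : Matrix (n × n) (n × n) ℂ := V ⊗ₖ (1 : Matrix n n ℂ) with hV'
  have uG : G' ∈ unitaryGroup (n × n) ℂ := kronecker_one_mem_unitaryGroup hG
  have uV : V' ∈ unitaryGroup (n × n) ℂ := kronecker_one_mem_unitaryGroup hV
  have hre : ∀ x : n × n → ℂ, t * euclNorm x ^ 2 ≤ (star (V' *ᵥ x) ⬝ᵥ (G' *ᵥ x)).re := by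
    intro x
    have e1 : star (V' *ᵥ x) ⬝ᵥ (G' *ᵥ x) = star x ⬝ᵥ (((Vᴴ * G) ⊗ₖ (1 : Matrix n n ℂ)) *ᵥ x) := by
      rw [star_mulVec, ← dotProduct_mulVec, mulVec_mulVec, hV', hG', conjTranspose_kronecker,
        conjTranspose_one, ← mul_kronecker_mul, one_mul]
    have e2 : star x ⬝ᵥ (((Vᴴ * G) ⊗ₖ (1 : Matrix n n ℂ)) *ᵥ x) =
        ∑ a, star (fun i => x (i, a)) ⬝ᵥ ((Vᴴ * G) *ᵥ fun i => x (i, a)) := by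
      simp only [dotProduct, Fintype.sum_prod_type, kronecker_one_mulVec]
      exact Finset.sum_comm
    have e3 : euclNorm x ^ 2 = ∑ a, euclNorm (fun i => x (i, a)) ^ 2 := by
      simp only [euclNorm_sq, Fintype.sum_prod_type]
      exact Finset.sum_comm
    rw [e1, e2, e3, Complex.re_sum, Finset.mul_sum]
    exact Finset.sum_le_sum fun a _ => h _
  set a : (n × n → ℂ) → n × n → ℂ := fun x => (u : ℂ) • (G' *ᵥ x) - (v : ℂ) • (V' *ᵥ x) with ha
  set b : (n × n → ℂ) → n × n → ℂ := fun x => (v : ℂ) • (G' *ᵥ x) - (u : ℂ) • (V' *ᵥ x) with hb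
  have hab : ∀ x, euclNorm (a x) ^ 2 + euclNorm (b x) ^ 2 ≤ 2 * s * euclNorm x ^ 2 := by
    intro x
    rw [ha, hb]
    simp only
    rw [euclNorm_real_smul_sub_sq, euclNorm_real_smul_sub_sq, euclNorm_unitary_mulVec uG,
      euclNorm_unitary_mulVec uV]
    have e : 2 * s = 2 * s⁻¹ - 2 * (t / s) * t := by
      field_simp
      linarith
    have h1 := mul_le_mul_of_nonneg_left (hre x) (show 0 ≤ 2 * (t / s) by positivity)
    rw [e]
    have h2 : u ^ 2 + v ^ 2 = s⁻¹ := by rw [hu2, hv2]; ring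
    have h3 : u ^ 2 * euclNorm x ^ 2 + v ^ 2 * euclNorm x ^ 2 = s⁻¹ * euclNorm x ^ 2 := by
      rw [← h2]; ring
    rw [← huv] at h1 ⊢
    linarith
  refine diamondNorm_le _ (by positivity) fun X hX => ?_
  rw [← mul_one (2 * s), ← hX]
  refine traceNorm_map_le _ (fun x y => ?_) X
  have key : ampliation n (unitaryChannel G - unitaryChannel V) (vecMulVec x (star y)) =
      vecMulVec (a x) (star (a y)) - vecMulVec (b x) (star (b y)) := by
    have hc : ((u : ℂ) ^ 2 - (v : ℂ) ^ 2) = 1 := by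
      have : u ^ 2 - v ^ 2 = 1 := by rw [hu2, hv2]; ring
      exact_mod_cast this
    have e : ∀ (W : Matrix (n × n) (n × n) ℂ), W * vecMulVec x (star y) * Wᴴ =
        vecMulVec (W *ᵥ x) (star (W *ᵥ y)) := fun W => by
      rw [mul_vecMulVec, vecMulVec_mul, star_mulVec]
    rw [ampliation_sub, ampliation_unitaryChannel, ampliation_unitaryChannel, ← hG', ← hV', e, e]
    ext p q
    simp only [ha, hb, Matrix.sub_apply, vecMulVec_apply, Pi.sub_apply, Pi.smul_apply, Pi.star_apply,
      star_sub, star_smul, smul_eq_mul, RCLike.star_def, Complex.conj_ofReal]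
    linear_combination (-((G' *ᵥ x) p * (starRingEnd ℂ) ((G' *ᵥ y) q)) +
      (V' *ᵥ x) p * (starRingEnd ℂ) ((V' *ᵥ y) q)) * hc
  rw [key]
  refine (traceNorm_sub_le _ _).trans ((add_le_add (traceNorm_vecMulVec_le _ _)
    (traceNorm_vecMulVec_le _ _)).trans ?_)
  have hx := hab x
  have hy := hab y
  have hx0 := euclNorm_nonneg x
  have hy0 := euclNorm_nonneg y
  refine abs_le_of_sq_le_sq' ?_ (by positivity) |>.2
  have h1 := mul_le_mul hx hy (by positivity) (by positivity)
  -- Cauchy-Schwarz in the plane, with the defect term as hint.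
  nlinarith [sq_nonneg (euclNorm (a x) * euclNorm (b y) - euclNorm (b x) * euclNorm (a y))]

/-- For `Y` the difference, the radicand is exactly `2 * tr (Y ^ 2) - (tr Y) ^ 2`, which
`two_mul_trace_sq_le` bounds. -/
theorem sqrt_le_traceNorm_vecMulVec_sub (x y : n → ℂ) :
    √((euclNorm x ^ 2 + euclNorm y ^ 2) ^ 2 - 4 * ‖star y ⬝ᵥ x‖ ^ 2) ≤
      traceNorm (vecMulVec x (star x) - vecMulVec y (star y)) := by
  refine Real.sqrt_le_iff.2 ⟨traceNorm_nonneg _, ?_⟩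
  have hh : ∀ x : n → ℂ, (vecMulVec x (star x)).IsHermitian := fun x => by
    rw [IsHermitian, conjTranspose_vecMulVec, star_star]
  have h := two_mul_trace_sq_le ((hh x).sub (hh y))
  rw [trace_vecMulVec_sub_sq, trace_sub, trace_vecMulVec, trace_vecMulVec,
    dotProduct_comm x (star x), dotProduct_comm y (star y), star_dotProduct_self x,
    star_dotProduct_self y, ← Complex.ofReal_sub,
    Complex.ofReal_re] at h
  linarith

theorem traceNorm_vecMulVec_self {x : n → ℂ} (hx : euclNorm x ^ 2 = 1) :
    traceNorm (vecMulVec x (star x)) = 1 := by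
  refine le_antisymm ((traceNorm_vecMulVec_le x x).trans (by rw [← sq, hx])) ?_
  have h := norm_trace_mul_le_traceNorm
    (norm_le_one_of_mem_unitaryGroup (one_mem (unitaryGroup n ℂ))) (vecMulVec x (star x))
  rw [one_mul, trace_vecMulVec, dotProduct_comm, star_dotProduct_self, hx] at h
  simpa using h

open scoped MatrixOrder ComplexOrder in
/-- The success of a pure input state whose reduced state is `ρ`. -/
theorem sum_sqrt_le_diamondNorm_measurementChannel_sub [Nonempty n] (U V : Matrix n n ℂ)
    {ρ : Matrix n n ℂ} (hρ : ρ.PosSemidef) (htr : ρ.trace = 1) :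
    ∑ i, √((((Uᴴ * ρ * U) i i).re + ((Vᴴ * ρ * V) i i).re) ^ 2 - 4 * ‖(Vᴴ * ρ * U) i i‖ ^ 2) ≤
      diamondNorm (measurementChannel U - measurementChannel V) := by
  obtain ⟨B, hB⟩ : ∃ B : Matrix n n ℂ, ρ = B * Bᴴ := by
    obtain ⟨B, hB⟩ := (CStarAlgebra.nonneg_iff_eq_mul_star_self (a := ρ)).1 hρ.nonneg
    exact ⟨B, hB⟩
  -- The entries of `B`, read as a bipartite vector, purify `ρ`. Measuring in the basis of `W`
  -- leaves row `i` of `Wᴴ * B` on the ancilla, so each diagonal block of the output difference is a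
  -- difference of two rank-one matrices.
  set ψ : n × n → ℂ := fun p => B p.1 p.2 with hψ
  have hdot : ∀ (W Z : Matrix n n ℂ) i,
      star ((Wᴴ * B) i) ⬝ᵥ (Zᴴ * B) i = (Zᴴ * ρ * W) i i := by
    intro W Z i
    have : Zᴴ * ρ * W = (Zᴴ * B) * (Wᴴ * B)ᴴ := by
      rw [hB, conjTranspose_mul, conjTranspose_conjTranspose]
      simp only [Matrix.mul_assoc]
    rw [this, Matrix.mul_apply, dotProduct_comm]
    rfl
  have hnorm : ∀ (W : Matrix n n ℂ) i, euclNorm ((Wᴴ * B) i) ^ 2 = ((Wᴴ * ρ * W) i i).re := by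
    intro W i
    rw [← hdot, star_dotProduct_self, Complex.ofReal_re]
  have hψ1 : euclNorm ψ ^ 2 = 1 := by
    refine Complex.ofReal_injective ?_
    rw [← star_dotProduct_self, Complex.ofReal_one, ← htr, hB]
    simp [trace, Matrix.mul_apply, dotProduct, Fintype.sum_prod_type, hψ, mul_comm]
  refine le_trans ?_ (traceNorm_ampliation_le _ (traceNorm_vecMulVec_self hψ1))
  refine le_trans ?_ (sum_traceNorm_le_traceNorm_blockDiagonal
    (fun i => vecMulVec ((Uᴴ * B) i) (star ((Uᴴ * B) i)) -
      vecMulVec ((Vᴴ * B) i) (star ((Vᴴ * B) i))) _ ?_)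
  · refine Finset.sum_le_sum fun i _ => le_trans (le_of_eq ?_)
      (sqrt_le_traceNorm_vecMulVec_sub _ _)
    have hc : Vᴴ * ρ * U = (Uᴴ * ρ * V)ᴴ := by
      rw [conjTranspose_mul, conjTranspose_mul, conjTranspose_conjTranspose, hρ.1.eq,
        Matrix.mul_assoc]
    rw [hnorm, hnorm, hdot, hc, conjTranspose_apply, norm_star]
  · intro i a b
    have e : ∀ (W : Matrix n n ℂ), ampliation n (measurementChannel W) (vecMulVec ψ (star ψ))
        (i, a) (i, b) = vecMulVec ((Wᴴ * B) i) (star ((Wᴴ * B) i)) a b := by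
      intro W
      rw [ampliation_measurementChannel]
      change (if i = i then _ else _) = _
      rw [if_pos rfl, mul_vecMulVec, vecMulVec_mul, ← star_mulVec, vecMulVec_apply,
        vecMulVec_apply, Pi.star_apply, kronecker_one_mulVec, kronecker_one_mulVec]
      rfl
    rw [ampliation_sub, Matrix.sub_apply, Matrix.sub_apply, e, e]

end Channels

/-! ### The minimax argument and the saddle point. -/

section Saddle

open Matrix
open scoped MatrixOrder ComplexOrder

variable {n : Type*} [Fintype n]

/-- The density matrices. -/
def densityMatrices (n : Type*) [Fintype n] : Set (Matrix n n ℂ) :=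
  {σ | σ.PosSemidef ∧ σ.trace = 1}

theorem convex_densityMatrices : Convex ℝ (densityMatrices n) := by
  intro σ hσ τ hτ a b ha hb hab
  refine ⟨(hσ.1.smul ha).add (hτ.1.smul hb), ?_⟩
  rw [trace_add, trace_smul, trace_smul, hσ.2, hτ.2, ← add_smul, hab, one_smul]

theorem vecMulVec_mem_densityMatrices {x : n → ℂ} (hx : x ≠ 0) :
    (euclNorm x ^ 2)⁻¹ • vecMulVec x (star x) ∈ densityMatrices n := by
  have h0 := (euclNorm_sq_pos hx).ne'
  refine ⟨(posSemidef_vecMulVec_self_star x).smul (inv_nonneg.2 (sq_nonneg _)), ?_⟩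
  rw [trace_smul, trace_vecMulVec, dotProduct_comm, star_dotProduct_self, Complex.real_smul,
    ← Complex.ofReal_mul, inv_mul_cancel₀ h0, Complex.ofReal_one]

variable [DecidableEq n]

theorem diagonal_mem_unitaryGroup_iff {e : n → ℂ} :
    diagonal e ∈ unitaryGroup n ℂ ↔ ∀ i, ‖e i‖ = 1 := by
  rw [mem_unitaryGroup_iff', star_eq_conjTranspose, diagonal_conjTranspose, diagonal_mul_diagonal,
    ← diagonal_one, diagonal_injective.eq_iff, funext_iff]
  refine forall_congr' fun i => ?_
  rw [Pi.star_apply, RCLike.star_def, Complex.conj_mul', ← Complex.ofReal_pow,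
    Complex.ofReal_eq_one]
  exact pow_eq_one_iff_of_nonneg (norm_nonneg _) two_ne_zero

theorem Matrix.PosSemidef.exists_eq_mul_conjTranspose {σ : Matrix n n ℂ} (hσ : σ.PosSemidef) :
    ∃ B : Matrix n n ℂ, σ = B * Bᴴ :=
  (CStarAlgebra.nonneg_iff_eq_mul_star_self (a := σ)).1 hσ.nonneg

/-- The density matrices are the continuous image of a compact unit sphere under `B ↦ B * Bᴴ`. -/
theorem exists_isMinOn_densityMatrices [Nonempty n] {f : Matrix n n ℂ → ℝ} (hf : Continuous f) :
    ∃ σ ∈ densityMatrices n, ∀ τ ∈ densityMatrices n, f σ ≤ f τ := by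
  set g : EuclideanSpace ℂ (n × n) → Matrix n n ℂ := fun x =>
    (Matrix.of fun i j => x (i, j)) * (Matrix.of fun i j => x (i, j))ᴴ with hg
  have hgc : Continuous g := by
    have h : Continuous fun x : EuclideanSpace ℂ (n × n) =>
        (Matrix.of fun i j => x (i, j) : Matrix n n ℂ) :=
      continuous_matrix fun i j => by fun_prop
    exact h.matrix_mul h.matrix_conjTranspose
  have htr : ∀ x, (g x).trace = ((‖x‖ ^ 2 : ℝ) : ℂ) := by
    intro x
    rw [EuclideanSpace.norm_sq_eq, Fintype.sum_prod_type]
    simp only [hg, trace, diag_apply, Matrix.mul_apply, conjTranspose_apply, of_apply]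
    push_cast
    exact Finset.sum_congr rfl fun i _ => Finset.sum_congr rfl fun j _ => by
      simpa using Complex.mul_conj' (x (i, j))
  obtain ⟨x, hx, hmin⟩ := (isCompact_sphere (0 : EuclideanSpace ℂ (n × n)) 1).exists_isMinOn
    (NormedSpace.sphere_nonempty.2 zero_le_one) (hf.comp hgc).continuousOn
  refine ⟨g x, ⟨posSemidef_self_mul_conjTranspose _, ?_⟩, fun τ hτ => ?_⟩
  · rw [htr, mem_sphere_zero_iff_norm.1 hx]
    simp
  · obtain ⟨B, hB⟩ := hτ.1.exists_eq_mul_conjTranspose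
    set y : EuclideanSpace ℂ (n × n) := WithLp.toLp 2 fun p => B p.1 p.2
    have hy : g y = τ := hB.symm
    have hy1 : ‖y‖ ^ 2 = 1 := by
      refine Complex.ofReal_injective ?_
      rw [← htr, hy, hτ.2, Complex.ofReal_one]
    have hy2 : y ∈ Metric.sphere (0 : EuclideanSpace ℂ (n × n)) 1 := by
      rw [mem_sphere_zero_iff_norm]
      nlinarith [norm_nonneg y]
    rw [← hy]
    exact hmin hy2

theorem continuousLinearMap_pi_eq_re_sum (f : (n → ℂ) →L[ℝ] ℝ) :
    ∃ z : n → ℂ, ∀ w, f w = (∑ i, z i * w i).re := by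
  refine ⟨fun i => ⟨f (Pi.single i 1), -f (Pi.single i Complex.I)⟩, fun w => ?_⟩
  conv_lhs => rw [← Finset.univ_sum_single w, map_sum]
  rw [Complex.re_sum]
  refine Finset.sum_congr rfl fun i _ => ?_
  have h : (Pi.single i (w i) : n → ℂ) =
      (w i).re • (Pi.single i 1 : n → ℂ) + (w i).im • (Pi.single i Complex.I : n → ℂ) := by
    rw [← Pi.single_smul, ← Pi.single_smul, ← Pi.single_add]
    congr 1
    apply Complex.ext <;> simp
  rw [h, map_add, map_smul, map_smul]
  simp
  ring

/-- The minimax theorem for the pairing of density matrices with diagonal contractions. -/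
theorem exists_diagonal_of_le_sum_norm [Nonempty n] {R : Matrix n n ℂ} {t : ℝ} (ht : 0 < t)
    (h : ∀ σ ∈ densityMatrices n, t ≤ ∑ i, ‖(σ * R) i i‖) :
    ∃ z : n → ℂ, (∀ i, ‖z i‖ ≤ 1) ∧
      ∀ x, t * euclNorm x ^ 2 ≤ (star x ⬝ᵥ ((R * diagonal z) *ᵥ x)).re := by
  have hs_conv : Convex ℝ {w : n → ℂ | ∑ i, ‖w i‖ < t} := by
    have hc : ConvexOn ℝ Set.univ fun w : n → ℂ => ∑ i, ‖w i‖ := by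
      refine ⟨convex_univ, fun w _ v _ a b ha hb _ => ?_⟩
      simp only [smul_eq_mul]
      rw [Finset.mul_sum, Finset.mul_sum, ← Finset.sum_add_distrib]
      refine Finset.sum_le_sum fun i _ => (norm_add_le _ _).trans (le_of_eq ?_)
      rw [Pi.smul_apply, Pi.smul_apply, norm_smul, norm_smul, Real.norm_of_nonneg ha,
        Real.norm_of_nonneg hb]
    simpa using hc.convex_lt t
  have hs_open : IsOpen {w : n → ℂ | ∑ i, ‖w i‖ < t} :=
    isOpen_lt (by fun_prop) continuous_const
  have hT : Convex ℝ ((fun (σ : Matrix n n ℂ) i => (σ * R) i i) '' densityMatrices n) := by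
    refine convex_densityMatrices.is_linear_image (f := fun (σ : Matrix n n ℂ) i => (σ * R) i i)
      ⟨fun σ τ => ?_, fun c σ => ?_⟩
    · ext i
      rw [Matrix.add_mul]
      rfl
    · ext i
      rw [Matrix.smul_mul]
      rfl
  -- The open `ℓ¹` ball of radius `t` is separated from the convex set of diagonals of `σ * R`. The
  -- separating functional has coefficients `z`, which `ℓ¹`-`ℓ∞` duality bounds by `u / t`.
  obtain ⟨f, u, hfu, huf⟩ := geometric_hahn_banach_open hs_conv hs_open hT (by
    rw [Set.disjoint_left]
    rintro _ hw ⟨σ, hσ, rfl⟩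
    exact absurd hw (not_lt.2 (h σ hσ)))
  obtain ⟨z, hz⟩ := continuousLinearMap_pi_eq_re_sum f
  have hu : 0 < u := by
    have := hfu 0 (by simpa using ht)
    rwa [map_zero] at this
  have hzu : ∀ i, t * ‖z i‖ ≤ u := by
    intro i
    by_contra! hcon
    have hzi : 0 < ‖z i‖ := by
      by_contra! h0
      have : ‖z i‖ = 0 := le_antisymm h0 (norm_nonneg _)
      rw [this, mul_zero] at hcon
      exact absurd hcon (not_lt.2 hu.le)
    have hzi' : (‖z i‖ : ℂ) ≠ 0 := by exact_mod_cast hzi.ne'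
    -- Chosen so that `z i * w = u`: the functional would reach `u` inside the open ball.
    set w : ℂ := ((u / ‖z i‖ ^ 2 : ℝ) : ℂ) * (starRingEnd ℂ) (z i) with hw
    have hwn : ‖w‖ = u / ‖z i‖ := by
      rw [hw, norm_mul, Complex.norm_real, RCLike.norm_conj, Real.norm_of_nonneg (by positivity)]
      field_simp
    have hzw : z i * w = (u : ℂ) := by
      rw [hw, mul_left_comm, Complex.mul_conj']
      push_cast
      field_simp
    have := hfu (Pi.single i w) (by
      have : ∑ j, ‖(Pi.single i w : n → ℂ) j‖ = ‖w‖ := by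
        rw [Finset.sum_eq_single i]
        · simp
        · intro j _ hj
          simp [hj]
        · simp
      rw [Set.mem_ofPred_eq, this, hwn, div_lt_iff₀ hzi]
      exact hcon)
    rw [hz, Finset.sum_eq_single i] at this
    · rw [Pi.single_eq_same, hzw, Complex.ofReal_re] at this
      exact lt_irrefl _ this
    · intro j _ hj
      simp [hj]
    · simp
  refine ⟨fun i => ((t / u : ℝ) : ℂ) * z i, fun i => ?_, fun x => ?_⟩
  · rw [norm_mul, Complex.norm_real, Real.norm_of_nonneg (by positivity), div_mul_eq_mul_div,
      div_le_one hu]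
    exact hzu i
  · by_cases hx : x = 0
    · subst hx
      simp [euclNorm]
    have hσ := vecMulVec_mem_densityMatrices hx
    have hN := euclNorm_sq_pos hx
    have h1 := huf _ ⟨_, hσ, rfl⟩
    rw [hz] at h1
    have h2 : ∑ i, z i * (((euclNorm x ^ 2)⁻¹ • vecMulVec x (star x)) * R) i i =
        (((euclNorm x ^ 2)⁻¹ : ℝ) : ℂ) * (star x ⬝ᵥ ((R * diagonal z) *ᵥ x)) := by
      have : star x ⬝ᵥ ((R * diagonal z) *ᵥ x) =
          (vecMulVec x (star x) * R * diagonal z).trace := by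
        rw [Matrix.mul_assoc, vecMulVec_mul, trace_vecMulVec, dotProduct_mulVec, dotProduct_comm]
      rw [this, trace, Finset.mul_sum]
      refine Finset.sum_congr rfl fun i _ => ?_
      rw [Matrix.smul_mul, Matrix.smul_apply, Complex.real_smul, diag_apply, mul_diagonal]
      ring
    rw [h2, Complex.re_ofReal_mul, inv_mul_eq_div, le_div_iff₀ hN] at h1
    have h3 : diagonal (fun i => ((t / u : ℝ) : ℂ) * z i) = ((t / u : ℝ) : ℂ) • diagonal z := by
      rw [← diagonal_smul]
      rfl
    rw [h3, Matrix.mul_smul, smul_mulVec, dotProduct_smul, smul_eq_mul, Complex.re_ofReal_mul]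
    calc t * euclNorm x ^ 2 = t / u * (u * euclNorm x ^ 2) := by field_simp
      _ ≤ _ := mul_le_mul_of_nonneg_left h1 (by positivity)

/-- Unitarity gives `K² v = μ K v - v`, so the span of `v` and `K v` is invariant and contains an
eigenvector of `K`. Its eigenvalue `κ` has modulus one and satisfies `κ * (μ - κ) = 1`, whence `μ -
κ` is the conjugate of `κ`. -/
theorem exists_eigenvector_of_unitary {K : Matrix n n ℂ} (hK : K ∈ unitaryGroup n ℂ) {μ : ℝ}
    {v : n → ℂ} (hv : v ≠ 0) (hKv : (K + Kᴴ) *ᵥ v = (μ : ℂ) • v) :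
    ∃ (κ : ℂ) (w : n → ℂ), w ≠ 0 ∧ K *ᵥ w = κ • w ∧ μ = 2 * κ.re := by
  have hKK : K * Kᴴ = 1 := mem_unitaryGroup_iff.1 hK
  have hnorm : ∀ (κ : ℂ) (w : n → ℂ), w ≠ 0 → K *ᵥ w = κ • w → κ * ((μ : ℂ) - κ) = 1 →
      μ = 2 * κ.re := by
    intro κ w hw hKw h
    have h1 := euclNorm_unitary_mulVec hK w
    have h2 : euclNorm (κ • w) = ‖κ‖ * euclNorm w := by
      rw [euclNorm, WithLp.toLp_smul, norm_smul, euclNorm]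
    have hN := (euclNorm_sq_pos hw).ne'
    rw [hKw, h2, mul_pow] at h1
    have h3 : ‖κ‖ ^ 2 = 1 := mul_right_cancel₀ hN (by rw [h1, one_mul])
    have h4 := Complex.mul_conj' κ
    rw [← Complex.ofReal_pow, h3, Complex.ofReal_one] at h4
    have hκ : κ ≠ 0 := by
      rintro rfl
      simp at h
    have h5 : (μ : ℂ) - κ = (starRingEnd ℂ) κ := mul_left_cancel₀ hκ (h.trans h4.symm)
    have h6 := congrArg Complex.re h5
    simp at h6
    linarith
  have hK2 : K *ᵥ (K *ᵥ v) = (μ : ℂ) • (K *ᵥ v) - v := by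
    have := congrArg (K *ᵥ ·) hKv
    simp only [add_mulVec, mulVec_add, mulVec_smul] at this
    rw [mulVec_mulVec v K Kᴴ, hKK, one_mulVec] at this
    exact eq_sub_of_add_eq this
  obtain ⟨l, hl⟩ : ∃ l : ℂ, l * ((μ : ℂ) - l) = 1 := by
    obtain ⟨s, hs⟩ := IsAlgClosed.exists_eq_mul_self ((μ : ℂ) ^ 2 - 4)
    exact ⟨(μ + s) / 2, by linear_combination (1 / 4 : ℂ) * hs⟩
  by_cases hy : K *ᵥ v = ((μ : ℂ) - l) • v
  · exact ⟨_, v, hv, hy, hnorm _ v hv hy (by linear_combination hl)⟩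
  · have hw : K *ᵥ v - ((μ : ℂ) - l) • v ≠ 0 := sub_ne_zero.2 hy
    have hKw : K *ᵥ (K *ᵥ v - ((μ : ℂ) - l) • v) = l • (K *ᵥ v - ((μ : ℂ) - l) • v) := by
      rw [mulVec_sub, mulVec_smul, hK2, smul_sub, smul_smul, hl]
      module
    exact ⟨l, _, hw, hKw, hnorm _ _ hw hKw hl⟩

/-- Replacing a diagonal contraction by its phases does not shrink the numerical range. -/
theorem exists_phases_posSemidef {R : Matrix n n ℂ} (hR : R ∈ unitaryGroup n ℂ) {t : ℝ}
    (ht : 0 < t) {z : n → ℂ} (hz : ∀ i, ‖z i‖ ≤ 1)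
    (h : ∀ x, t * euclNorm x ^ 2 ≤ (star x ⬝ᵥ ((R * diagonal z) *ᵥ x)).re) :
    ∃ e : n → ℂ, (∀ i, ‖e i‖ = 1) ∧
      (R * diagonal e + (R * diagonal e)ᴴ - ((2 * t : ℝ) : ℂ) • 1).PosSemidef := by
  -- A vanishing `z i` would contradict the lower bound at the basis vector `i`, so every phase is
  -- defined.
  have hz0 : ∀ i, ‖z i‖ ≠ 0 := by
    intro i h0
    have h1 := h (Pi.single i 1)
    have h2 : euclNorm (Pi.single i 1 : n → ℂ) ^ 2 = 1 := by
      have := star_dotProduct_self (Pi.single i 1 : n → ℂ)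
      simp at this
      exact_mod_cast this.symm
    have h3 : (R * diagonal z) *ᵥ Pi.single i 1 = 0 := by
      ext j
      simp [norm_eq_zero.1 h0]
    rw [h2, h3, dotProduct_zero, Complex.zero_re, mul_one] at h1
    exact absurd ht (not_lt.2 h1)
  have hz0' : ∀ i, (‖z i‖ : ℂ) ≠ 0 := fun i => by exact_mod_cast hz0 i
  set e : n → ℂ := fun i => z i / (‖z i‖ : ℂ) with he
  have he1 : ∀ i, ‖e i‖ = 1 := fun i => by
    rw [he]
    simp only
    rw [norm_div, Complex.norm_real, norm_norm, div_self (hz0 i)]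
  set K := R * diagonal e with hKdef
  have hK : K ∈ unitaryGroup n ℂ := mul_mem hR (diagonal_mem_unitaryGroup_iff.2 he1)
  -- Testing the hypothesis at `x = |z|⁻¹ w` gives `R * diagonal z` applied to `x` equal to `κ • w`,
  -- so `t ‖x‖²` is at most `κ.re * ∑ ‖z i‖ ‖x i‖²`. That sum is positive and at most `‖x‖²`.
  have heig : ∀ (κ : ℂ) (w : n → ℂ), w ≠ 0 → K *ᵥ w = κ • w → t ≤ κ.re := by
    intro κ w hw hKw
    set x : n → ℂ := fun i => w i / (‖z i‖ : ℂ) with hx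
    have hwx : ∀ i, w i = (‖z i‖ : ℂ) * x i := fun i => by
      rw [hx]
      field_simp [hz0' i]
    have h1 : (R * diagonal z) *ᵥ x = κ • w := by
      rw [← hKw, hKdef, ← mulVec_mulVec, ← mulVec_mulVec]
      congr 1
      ext i
      rw [mulVec_diagonal, mulVec_diagonal, hwx i, he]
      field_simp [hz0' i]
    have h2 : star x ⬝ᵥ w = ((∑ i, ‖z i‖ * ‖x i‖ ^ 2 : ℝ) : ℂ) := by
      rw [dotProduct, Complex.ofReal_sum]
      refine Finset.sum_congr rfl fun i _ => ?_
      rw [hwx i, mul_left_comm, Pi.star_apply, RCLike.star_def, Complex.conj_mul']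
      push_cast
      rfl
    have h3 := h x
    rw [h1, dotProduct_smul, h2, smul_eq_mul, mul_comm κ, Complex.re_ofReal_mul] at h3
    have h4 : ∑ i, ‖z i‖ * ‖x i‖ ^ 2 ≤ euclNorm x ^ 2 := by
      rw [euclNorm_sq]
      exact Finset.sum_le_sum fun i _ => mul_le_of_le_one_left (sq_nonneg _) (hz i)
    have h5 : 0 < ∑ i, ‖z i‖ * ‖x i‖ ^ 2 := by
      obtain ⟨i, hi⟩ := Function.ne_iff.1 hw
      refine Finset.sum_pos' (fun i _ => by positivity) ⟨i, Finset.mem_univ i, ?_⟩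
      have hxi : x i ≠ 0 := fun h0 => hi (by rw [hwx i, h0, mul_zero]; rfl)
      have := norm_pos_iff.2 hxi
      have := lt_of_le_of_ne (norm_nonneg (z i)) (hz0 i).symm
      positivity
    refine le_of_mul_le_mul_left ?_ h5
    nlinarith
  refine ⟨e, he1, ?_⟩
  have hH : (K + Kᴴ - ((2 * t : ℝ) : ℂ) • (1 : Matrix n n ℂ)).IsHermitian := by
    rw [IsHermitian, conjTranspose_sub, conjTranspose_add, conjTranspose_conjTranspose,
      conjTranspose_smul, conjTranspose_one, add_comm Kᴴ, RCLike.star_def, Complex.conj_ofReal]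
  rw [hH.posSemidef_iff_eigenvalues_nonneg]
  intro i
  have hv := hH.mulVec_eigenvectorBasis i
  have hv0 : (hH.eigenvectorBasis i).ofLp ≠ 0 := fun h0 =>
    hH.eigenvectorBasis.toBasis.ne_zero i (by
      rw [OrthonormalBasis.coe_toBasis]
      exact WithLp.ofLp_injective 2 h0)
  obtain ⟨κ, w, hw, hKw, hμ⟩ := exists_eigenvector_of_unitary hK
    (μ := hH.eigenvalues i + 2 * t) hv0 (by
      rw [sub_mulVec, smul_mulVec, one_mulVec, sub_eq_iff_eq_add] at hv
      rw [hv, Complex.ofReal_add, add_smul]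
      rfl)
  have := heig κ w hw hKw
  change 0 ≤ hH.eigenvalues i
  linarith

/-- Complementary slackness: with `σ = B * Bᴴ` and `M = C * Cᴴ`, the trace is the squared Frobenius
norm of `Cᴴ * B`. -/
theorem mul_eq_zero_of_trace_mul_le {M σ : Matrix n n ℂ} (hM : M.PosSemidef) (hσ : σ.PosSemidef)
    (h : (σ * M).trace.re ≤ 0) : M * σ = 0 := by
  obtain ⟨B, hB⟩ := hσ.exists_eq_mul_conjTranspose
  obtain ⟨C, hC⟩ := hM.exists_eq_mul_conjTranspose
  have h1 : (σ * M).trace = ((Cᴴ * B)ᴴ * (Cᴴ * B)).trace := by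
    rw [hB, hC, conjTranspose_mul, conjTranspose_conjTranspose, Matrix.mul_assoc, trace_mul_comm]
    simp only [Matrix.mul_assoc]
  have h2 := (posSemidef_conjTranspose_mul_self (Cᴴ * B)).trace_nonneg
  rw [← h1] at h2
  have h3 : (σ * M).trace = 0 := by
    rw [Complex.le_def] at h2
    exact Complex.ext (le_antisymm h h2.1) h2.2.symm
  rw [h1, trace_conjTranspose_mul_self_eq_zero_iff] at h3
  rw [hB, hC, Matrix.mul_assoc, ← Matrix.mul_assoc Cᴴ, h3, Matrix.zero_mul, Matrix.mul_zero]

/-- On the eigenspace of `K + Kᴴ` for `2 * t`, the unitary `K` can only have the eigenvalues `t ± i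
√(1 - t ^ 2)`, so `T = K - Kᴴ` acts there as a multiple of a reflection. Averaging `σ` with its
reflected copy gives `τ` commuting with `K`, hence equal diagonals of `Rᴴ * τ * R` and `τ`. -/
theorem exists_density_of_saddle {R : Matrix n n ℂ} (hR : R ∈ unitaryGroup n ℂ) {t : ℝ}
    (ht0 : 0 ≤ t) (ht1 : t < 1) {e : n → ℂ} (he : ∀ i, ‖e i‖ = 1)
    (hpos : (R * diagonal e + (R * diagonal e)ᴴ - ((2 * t : ℝ) : ℂ) • 1).PosSemidef)
    {σ : Matrix n n ℂ} (hσ : σ ∈ densityMatrices n) (hσt : ∑ i, ‖(σ * R) i i‖ = t) :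
    ∃ τ ∈ densityMatrices n, ∀ i, (Rᴴ * τ * R) i i = τ i i ∧ ‖(τ * R) i i‖ = t * (τ i i).re := by
  have hee : ∀ i, (starRingEnd ℂ) (e i) * e i = 1 := fun i => by
    have := Complex.conj_mul' (e i)
    rw [he i] at this
    simpa using this
  set K := R * diagonal e with hKdef
  have hK : K ∈ unitaryGroup n ℂ := mul_mem hR (diagonal_mem_unitaryGroup_iff.2 he)
  have hKK : K * Kᴴ = 1 := mem_unitaryGroup_iff.1 hK
  have hKK' : Kᴴ * K = 1 := mem_unitaryGroup_iff'.1 hK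
  have hdiag : ∀ (τ : Matrix n n ℂ) i, (τ * K) i i = (τ * R) i i * e i := fun τ i => by
    rw [hKdef, ← Matrix.mul_assoc, mul_diagonal]
  have hσH : σᴴ = σ := hσ.1.1
  have hKstar : (σ * Kᴴ).trace = star (σ * K).trace := by
    rw [← trace_conjTranspose, conjTranspose_mul σ K, hσH, trace_mul_comm]
  have hle : ∀ i, ((σ * K) i i).re ≤ ‖(σ * R) i i‖ := fun i => by
    refine (Complex.re_le_norm _).trans ?_
    rw [hdiag, norm_mul, he, mul_one]
  have htrM : (σ * (K + Kᴴ - ((2 * t : ℝ) : ℂ) • 1)).trace.re =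
      2 * ∑ i, ((σ * K) i i).re - 2 * t := by
    rw [Matrix.mul_sub, Matrix.mul_add, trace_sub, trace_add, hKstar, Matrix.mul_smul, mul_one,
      trace_smul, hσ.2, trace]
    simp
    ring
  have hsum : ∑ i, ((σ * K) i i).re ≤ t := (Finset.sum_le_sum fun i _ => hle i).trans hσt.le
  have hMσ := mul_eq_zero_of_trace_mul_le hpos hσ.1 (by rw [htrM]; linarith)
  have hsum' : t ≤ ∑ i, ((σ * K) i i).re := by
    have : (σ * (K + Kᴴ - ((2 * t : ℝ) : ℂ) • 1)).trace.re = 0 := by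
      rw [trace_mul_comm, hMσ, trace_zero, Complex.zero_re]
    linarith
  -- Equality of the sums forces `re = norm` in every term, so each diagonal entry of `σ * K` is
  -- real.
  have hreal : ∀ i, star ((σ * K) i i) = (σ * K) i i := by
    intro i
    have h1 := (Finset.sum_eq_sum_iff_of_le fun i _ => hle i).1
      (le_antisymm (hsum.trans hσt.ge) (hσt.le.trans hsum')) i (Finset.mem_univ i)
    have h2 : ‖(σ * K) i i‖ = ‖(σ * R) i i‖ := by rw [hdiag, norm_mul, he, mul_one]
    rw [← h2] at h1
    have h3 := Complex.sq_norm_sub_sq_re ((σ * K) i i)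
    rw [h1, sub_self] at h3
    refine Complex.conj_eq_iff_im.2 (pow_eq_zero_iff two_ne_zero |>.1 h3.symm)
  set A := K + Kᴴ with hA
  set T := K - Kᴴ with hT
  have hAσ : A * σ = ((2 * t : ℝ) : ℂ) • σ := by
    rw [Matrix.sub_mul, Matrix.smul_mul, one_mul, sub_eq_zero] at hMσ
    exact hMσ
  have hAH : Aᴴ = A := by rw [hA, conjTranspose_add, conjTranspose_conjTranspose, add_comm]
  have hTH : Tᴴ = -T := by rw [hT, conjTranspose_sub, conjTranspose_conjTranspose, neg_sub]
  have hσA : σ * A = ((2 * t : ℝ) : ℂ) • σ := by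
    have := congrArg conjTranspose hAσ
    rwa [conjTranspose_mul, hAH, conjTranspose_smul, hσH, RCLike.star_def,
      Complex.conj_ofReal] at this
  have hAT : A * T = T * A := by
    rw [hA, hT]
    simp only [Matrix.add_mul, Matrix.mul_add, Matrix.sub_mul, Matrix.mul_sub, hKK, hKK']
    abel
  have hTT : T * T = A * A - (4 : ℂ) • 1 := by
    rw [hA, hT]
    simp only [Matrix.add_mul, Matrix.mul_add, Matrix.sub_mul, Matrix.mul_sub, hKK, hKK']
    module
  have hc0 : (4 * (1 - t ^ 2) : ℝ) ≠ 0 := by nlinarith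
  have hc0' : (4 * (1 - (t : ℂ) ^ 2)) ≠ 0 := by exact_mod_cast hc0
  have hTTσ : T * T * σ = (-(4 * (1 - (t : ℂ) ^ 2))) • σ := by
    rw [hTT, Matrix.sub_mul, Matrix.mul_assoc, hAσ, Matrix.mul_smul, hAσ, Matrix.smul_mul,
      one_mul, smul_smul, ← sub_smul]
    congr 1
    push_cast
    ring
  have hσTT : σ * (T * T) = (-(4 * (1 - (t : ℂ) ^ 2))) • σ := by
    rw [hTT, Matrix.mul_sub, ← Matrix.mul_assoc, hσA, Matrix.smul_mul, hσA, Matrix.mul_smul,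
      mul_one, smul_smul, ← sub_smul]
    congr 1
    push_cast
    ring
  -- The factor normalizes `T` to a reflection: on the range of `σ`, `T * T` is `-4 * (1 - t ^ 2)`.
  -- The minus sign in `τ` comes from `Tᴴ = -T`.
  set c : ℂ := (4 * (1 - (t : ℂ) ^ 2))⁻¹ with hc
  set τ := (2⁻¹ : ℂ) • (σ - c • (T * σ * T)) with hτ
  have hTτ : T * τ = (2⁻¹ : ℂ) • (T * σ + σ * T) := by
    have : T * (T * σ * T) = (T * T * σ) * T := by simp only [Matrix.mul_assoc]
    rw [hτ, Matrix.mul_smul, Matrix.mul_sub, Matrix.mul_smul, this, hTTσ, Matrix.smul_mul,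
      smul_smul, mul_neg, hc, inv_mul_cancel₀ hc0', neg_smul, one_smul, sub_neg_eq_add]
  have hτT : τ * T = (2⁻¹ : ℂ) • (T * σ + σ * T) := by
    have : T * σ * T * T = T * (σ * (T * T)) := by simp only [Matrix.mul_assoc]
    rw [hτ, Matrix.smul_mul, Matrix.sub_mul, Matrix.smul_mul, this, hσTT, Matrix.mul_smul,
      smul_smul, mul_neg, hc, inv_mul_cancel₀ hc0', neg_smul, one_smul, sub_neg_eq_add, add_comm]
  have hAτ : A * τ = ((2 * t : ℝ) : ℂ) • τ := by
    have : A * (T * σ * T) = T * (A * σ) * T := by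
      rw [← Matrix.mul_assoc, ← Matrix.mul_assoc, hAT]
      simp only [Matrix.mul_assoc]
    rw [hτ, Matrix.mul_smul, Matrix.mul_sub, Matrix.mul_smul, this, hAσ, Matrix.mul_smul,
      Matrix.smul_mul]
    module
  have hτA : τ * A = ((2 * t : ℝ) : ℂ) • τ := by
    have : T * σ * T * A = T * (σ * A) * T := by
      rw [Matrix.mul_assoc _ T A, ← hAT]
      simp only [Matrix.mul_assoc]
    rw [hτ, Matrix.smul_mul, Matrix.sub_mul, Matrix.smul_mul, this, hσA, Matrix.mul_smul,
      Matrix.smul_mul]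
    module
  have hK2 : K = (2⁻¹ : ℂ) • (A + T) := by
    rw [hA, hT]
    module
  have hcomm : τ * K = K * τ := by
    rw [hK2, Matrix.mul_smul τ, Matrix.smul_mul _ _ τ, Matrix.mul_add τ A T, Matrix.add_mul A T τ, hTτ,
      hτT, hAτ, hτA]
  -- Since `σ` commutes with `A`, the anticommutator is twice `σ * K` minus its adjoint, whose
  -- diagonal vanishes by `hreal`.
  have hanti : ∀ i, (T * σ + σ * T) i i = 0 := by
    intro i
    have h1 : T * σ + σ * T = (2 : ℂ) • (σ * K - (σ * K)ᴴ) := by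
      have h2 : (σ * K)ᴴ = (2⁻¹ : ℂ) • (A * σ - T * σ) := by
        rw [conjTranspose_mul, hσH, ← Matrix.sub_mul, hA, hT, ← Matrix.smul_mul]
        congr 1
        module
      have h3 : σ * K = (2⁻¹ : ℂ) • (σ * A + σ * T) := by
        rw [← Matrix.mul_add, ← Matrix.mul_smul, ← hK2]
      rw [h2, h3, hAσ, hσA]
      module
    rw [h1, Matrix.smul_apply, Matrix.sub_apply, conjTranspose_apply, hreal, sub_self, smul_zero]
  have hτK : ∀ i, (τ * K) i i = (t : ℂ) * τ i i := by
    intro i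
    rw [hK2, Matrix.mul_smul, Matrix.mul_add, hτA, hτT, Matrix.smul_apply, Matrix.add_apply,
      Matrix.smul_apply, Matrix.smul_apply, hanti]
    simp only [smul_eq_mul]
    push_cast
    ring
  have hτpos : τ.PosSemidef := by
    have h1 : τ = (2⁻¹ : ℝ) • (σ + (4 * (1 - t ^ 2))⁻¹ • (T * σ * Tᴴ)) := by
      rw [hτ, hTH, Matrix.mul_neg, smul_neg, ← sub_eq_add_neg, hc,
        ← Complex.coe_smul (2⁻¹ : ℝ), ← Complex.coe_smul (4 * (1 - t ^ 2))⁻¹]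
      push_cast
      rfl
    rw [h1]
    have h2 : (0 : ℝ) ≤ (4 * (1 - t ^ 2))⁻¹ := inv_nonneg.2 (by nlinarith)
    exact (hσ.1.add ((hσ.1.mul_mul_conjTranspose_same T).smul h2)).smul (by norm_num)
  refine ⟨τ, ⟨hτpos, ?_⟩, fun i => ⟨?_, ?_⟩⟩
  · rw [hτ, trace_smul, trace_sub, trace_smul, trace_mul_comm, ← Matrix.mul_assoc, hTTσ,
      trace_smul, hσ.2, hc]
    simp only [smul_eq_mul]
    rw [mul_one, mul_neg, inv_mul_cancel₀ hc0']
    norm_num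
  · have h1 : (Kᴴ * τ * K) i i = (Rᴴ * τ * R) i i := by
      have : Kᴴ * τ * K = diagonal (star e) * (Rᴴ * τ * R) * diagonal e := by
        rw [hKdef, conjTranspose_mul, diagonal_conjTranspose]
        simp only [Matrix.mul_assoc]
      rw [this, mul_diagonal, diagonal_mul, mul_right_comm, Pi.star_apply, RCLike.star_def, hee,
        one_mul]
    rw [← h1, Matrix.mul_assoc, hcomm, ← Matrix.mul_assoc, hKK', one_mul]
  · have h1 : ‖(τ * R) i i‖ = ‖(τ * K) i i‖ := by rw [hdiag, norm_mul, he, mul_one]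
    have h2 : 0 ≤ τ i i := hτpos.diag_nonneg
    rw [h1, hτK, norm_mul, Complex.norm_real, Real.norm_of_nonneg ht0]
    congr 1
    rw [Complex.le_def] at h2
    have h3 : τ i i = ((τ i i).re : ℂ) := Complex.ext rfl h2.2.symm
    rw [h3, Complex.norm_real, Complex.ofReal_re, Real.norm_of_nonneg h2.1]

end Saddle

/-! ### Optimal phases and the equality of the distances. -/

section Main

open Matrix
open scoped MatrixOrder ComplexOrder

variable {n : Type*} [Fintype n] [DecidableEq n]

/-- The reduced input state is taken to be `V * σ * Vᴴ`, so that only `Vᴴ * U` enters. -/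
theorem sum_sqrt_density_le [Nonempty n] {U V : Matrix n n ℂ}
    (hV : V ∈ unitaryGroup n ℂ) {σ : Matrix n n ℂ} (hσ : σ ∈ densityMatrices n) :
    ∑ i, √(((((Vᴴ * U)ᴴ * σ * (Vᴴ * U)) i i).re + (σ i i).re) ^ 2 -
      4 * ‖(σ * (Vᴴ * U)) i i‖ ^ 2) ≤
      diamondNorm (measurementChannel U - measurementChannel V) := by
  have hVV : Vᴴ * V = 1 := mem_unitaryGroup_iff'.1 hV
  have h := sum_sqrt_le_diamondNorm_measurementChannel_sub U V
    (hσ.1.mul_mul_conjTranspose_same V) (by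
      rw [Matrix.mul_assoc, trace_mul_comm, Matrix.mul_assoc, hVV, mul_one, hσ.2])
  have h1 : Uᴴ * (V * σ * Vᴴ) * U = (Vᴴ * U)ᴴ * σ * (Vᴴ * U) := by
    rw [conjTranspose_mul, conjTranspose_conjTranspose]
    simp only [Matrix.mul_assoc]
  have h2 : ∀ W, Vᴴ * (V * σ * Vᴴ) * W = σ * (Vᴴ * W) := fun W => by
    rw [← Matrix.mul_assoc, ← Matrix.mul_assoc, hVV, one_mul, Matrix.mul_assoc]
  simpa only [h1, h2, hVV, mul_one] using h

/-- An optimal choice of phases. -/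
theorem exists_phases_diamondNorm_le [Nonempty n] {U V : Matrix n n ℂ}
    (hU : U ∈ unitaryGroup n ℂ) (hV : V ∈ unitaryGroup n ℂ) :
    ∃ e : n → ℂ, (∀ i, ‖e i‖ = 1) ∧
      diamondNorm (unitaryChannel (U * diagonal e) - unitaryChannel V) ≤
        diamondNorm (measurementChannel U - measurementChannel V) := by
  have hR : Vᴴ * U ∈ unitaryGroup n ℂ := mul_mem (Unitary.star_mem hV) hU
  set R := Vᴴ * U with hRdef
  obtain ⟨σ, hσ, hmin⟩ := exists_isMinOn_densityMatrices
    (f := fun σ : Matrix n n ℂ => ∑ i, ‖(σ * R) i i‖) (by fun_prop)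
  set t := ∑ i, ‖(σ * R) i i‖ with ht
  have ht0 : 0 ≤ t := Finset.sum_nonneg fun i _ => norm_nonneg _
  rcases ht0.eq_or_lt with h0 | h0
  -- All overlaps vanish at `σ`, so its value is the sum of two traces, 2, which no pair of unitary
  -- channels exceeds; any phases will do.
  · refine ⟨1, fun i => norm_one, ?_⟩
    have hd : (diagonal 1 : Matrix n n ℂ) = 1 := diagonal_one
    rw [hd, mul_one]
    refine (diamondNorm_unitaryChannel_sub_le_two hU hV).trans
      (le_trans (le_of_eq ?_) (sum_sqrt_density_le hV hσ))
    have hc : ∀ i, ‖(σ * R) i i‖ = 0 := fun i =>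
      (Finset.sum_eq_zero_iff_of_nonneg fun i _ => norm_nonneg _).1 (ht.symm.trans h0.symm) i
        (Finset.mem_univ i)
    have hp : ∀ {τ : Matrix n n ℂ}, τ.PosSemidef → ∀ i, 0 ≤ (τ i i).re := fun h i =>
      (Complex.le_def.1 h.diag_nonneg).1
    have htr : ∀ {τ : Matrix n n ℂ}, τ.trace = 1 → ∑ i, (τ i i).re = 1 := fun h => by
      rw [← Complex.one_re, ← h, trace, Complex.re_sum]
      rfl
    have hRR : R * Rᴴ = 1 := mem_unitaryGroup_iff.1 hR
    rw [← hRdef]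
    have hτ := hσ.1.conjTranspose_mul_mul_same R
    have hτ1 : (Rᴴ * σ * R).trace = 1 := by
      rw [Matrix.mul_assoc, trace_mul_comm, Matrix.mul_assoc, hRR, mul_one, hσ.2]
    simp only [hc]
    have hs : ∀ i, √((((Rᴴ * σ * R) i i).re + (σ i i).re) ^ 2 - 4 * (0 : ℝ) ^ 2) =
        ((Rᴴ * σ * R) i i).re + (σ i i).re := fun i => by
      rw [zero_pow two_ne_zero, mul_zero, sub_zero, Real.sqrt_sq (add_nonneg (hp hτ i) (hp hσ.1 i))]
    rw [Finset.sum_congr rfl fun i _ => hs i, Finset.sum_add_distrib, htr hτ1, htr hσ.2]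
    norm_num
  · obtain ⟨z, hz, hzt⟩ := exists_diagonal_of_le_sum_norm h0 hmin
    obtain ⟨e, he, hpos⟩ := exists_phases_posSemidef hR h0 hz hzt
    refine ⟨e, he, ?_⟩
    have hG : U * diagonal e ∈ unitaryGroup n ℂ :=
      mul_mem hU (diagonal_mem_unitaryGroup_iff.2 he)
    have hre : ∀ x, t * euclNorm x ^ 2 ≤ (star x ⬝ᵥ ((Vᴴ * (U * diagonal e)) *ᵥ x)).re := by
      intro x
      rw [← Matrix.mul_assoc, ← hRdef]
      have h := (Complex.le_def.1 (hpos.dotProduct_mulVec_nonneg x)).1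
      have h2 : star x ⬝ᵥ ((R * diagonal e)ᴴ *ᵥ x) =
          star (star x ⬝ᵥ ((R * diagonal e) *ᵥ x)) := by
        rw [star_dotProduct, star_mulVec, conjTranspose_conjTranspose, ← dotProduct_mulVec]
      rw [sub_mulVec, add_mulVec, dotProduct_sub, dotProduct_add, h2, smul_mulVec, one_mulVec,
        dotProduct_smul, star_dotProduct_self, smul_eq_mul, ← Complex.ofReal_mul,
        Complex.sub_re, Complex.add_re, RCLike.star_def, Complex.conj_re, Complex.ofReal_re,
        Complex.zero_re] at h
      linarith
    rcases lt_or_ge t 1 with h1 | h1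
    · refine (diamondNorm_unitaryChannel_sub_le hG hV ht0 h1 hre).trans ?_
      obtain ⟨τ, hτ, hτR⟩ := exists_density_of_saddle hR ht0 h1 he hpos hσ ht.symm
      refine le_trans (le_of_eq ?_) (sum_sqrt_density_le hV hτ)
      rw [← hRdef]
      have hs : ∀ i, √((((Rᴴ * τ * R) i i).re + (τ i i).re) ^ 2 - 4 * ‖(τ * R) i i‖ ^ 2) =
          2 * √(1 - t ^ 2) * (τ i i).re := fun i => by
        have hp : 0 ≤ (τ i i).re := (Complex.le_def.1 hτ.1.diag_nonneg).1
        rw [(hτR i).1, (hτR i).2]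
        have : ((τ i i).re + (τ i i).re) ^ 2 - 4 * (t * (τ i i).re) ^ 2 =
            (2 * (τ i i).re) ^ 2 * (1 - t ^ 2) := by ring
        rw [this, Real.sqrt_mul (sq_nonneg _), Real.sqrt_sq (by positivity)]
        ring
      rw [Finset.sum_congr rfl fun i _ => hs i, ← Finset.mul_sum]
      have : ∑ i, (τ i i).re = 1 := by
        rw [← Complex.one_re, ← hτ.2, trace, Complex.re_sum]
        rfl
      rw [this, mul_one]
    -- For unit `x`, `‖U e x - V x‖² = 2 - 2 Re ⟨V x, U e x⟩ ≤ 2 - 2 * t ≤ 0`.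
    · have hGV : U * diagonal e = V := by
        refine Matrix.ext_of_mulVec_single fun i => ?_
        set x : n → ℂ := Pi.single i 1
        have h2 := euclNorm_real_smul_sub_sq 1 1 ((U * diagonal e) *ᵥ x) (V *ᵥ x)
        rw [Complex.ofReal_one, one_smul, one_smul, euclNorm_unitary_mulVec hG,
          euclNorm_unitary_mulVec hV, star_mulVec, ← dotProduct_mulVec, mulVec_mulVec] at h2
        have h3 := hre x
        by_contra hne
        have h4 := euclNorm_sq_pos (sub_ne_zero.2 hne)
        nlinarith [sq_nonneg (euclNorm x)]
      rw [hGV, sub_self, diamondNorm_zero]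
      exact diamondNorm_nonneg _

end Main

theorem mainTheorem1 (d : ℕ) (U V : Matrix (Fin d) (Fin d) ℂ)
    (hU : U ∈ Matrix.unitaryGroup (Fin d) ℂ) (hV : V ∈ Matrix.unitaryGroup (Fin d) ℂ) :
    IsLeast
      {r : ℝ | ∃ E ∈ diagonalUnitary d,
        r = diamondNorm (unitaryChannel (U * E) - unitaryChannel V)}
      (diamondNorm (measurementChannel U - measurementChannel V)) := by
  rcases Nat.eq_zero_or_pos d with rfl | hd
  · have hUV : ∀ A : Matrix (Fin 0) (Fin 0) ℂ, A = V := fun A => Subsingleton.elim _ _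
    refine ⟨⟨1, ⟨one_mem _, Matrix.isDiag_one⟩, ?_⟩, ?_⟩
    · rw [hUV (U * 1), hUV U, sub_self, sub_self, diamondNorm_zero]
    · rintro _ ⟨E, -, rfl⟩
      rw [hUV U, sub_self, diamondNorm_zero]
      exact diamondNorm_nonneg _
  · have : Nonempty (Fin d) := ⟨⟨0, hd⟩⟩
    have hle : ∀ e : Fin d → ℂ, (∀ i, ‖e i‖ = 1) →
        diamondNorm (measurementChannel U - measurementChannel V) ≤
          diamondNorm (unitaryChannel (U * Matrix.diagonal e) - unitaryChannel V) := by
      intro e he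
      rw [← measurementChannel_mul_diagonal U he]
      exact diamondNorm_measurementChannel_sub_le
        (mul_mem hU (diagonal_mem_unitaryGroup_iff.2 he)) hV
    refine ⟨?_, ?_⟩
    · obtain ⟨e, he, h⟩ := exists_phases_diamondNorm_le hU hV
      exact ⟨Matrix.diagonal e, ⟨diagonal_mem_unitaryGroup_iff.2 he, Matrix.isDiag_diagonal e⟩,
        le_antisymm (hle e he) h⟩
    · rintro _ ⟨E, ⟨hE, hdiag⟩, rfl⟩
      rw [← hdiag.diagonal_diag] at hE ⊢
      exact hle _ (diagonal_mem_unitaryGroup_iff.1 hE)
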